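/- Let $N\ge 2$, let $G>0$ and let $m_1,\dots,m_N>0$. Let $\Delta=\{q=(q_1,\dots,q_N)\in\mathbb R^{3N} : q_i=q_j \text{ for some } i\ne j\}$. Consider the $N$-body equations $$\frac{dq_i}{dt}=v_i,\qquad \frac{dv_i}{dt}=\sum_{j\ne i}\frac{G m_j}{\|q_i-q_j\|^3}(q_j-q_i),\qquad i=1,\dots,N. \qquad (1)$$ For $q\in\mathbb R^{3N}\setminus\Delta$ and $v\in\mathbb R^{3N}$ put $$K_i(q)=\sum_{k\neq i}\frac{G m_k}{\|q_i-q_k\|^2},\qquad s(q,v)=\Bigl(\sum_{1\le i<j\le N}\frac{\|v_i-v_j\|^2}{\|q_i-q_j\|^2}+\sum_{1\le i<j\le N}\frac{K_i(q)+K_j(q)}{\|q_i-q_j\|}\Bigr)^{-1/2},$$ and consider the renormalized equations $$\frac{d\hat q_i}{d\tau}=s(\hat q,\hat v)\,\hat v_i,\qquad \frac{d\hat v_i}{d\tau}=s(\hat q,\hat v)\sum_{j\ne i}\frac{G m_j}{\|\hat q_i-\hat q_j\|^3}(\hat q_j-\hat q_i),\qquad \hat q(0)=q^0,\ \hat v(0)=v^0.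 \qquad (2)$$ Let $\beta=0.0444443$. (a) For all $q^0\in\mathbb R^{3N}\setminus\Delta$ and $v^0\in\mathbb R^{3N}$, problem (2) has a solution $(\hat q,\hat v)$ defined for all $\tau\in\mathbb R$, with $\hat q(\tau)\notin\Delta$, and it is the only solution on every open interval around $0$. It extends uniquely to a function that is holomorphic on (a neighbourhood of) the closed strip $\{\tau\in\mathbb C : |\mathrm{Im}\,\tau|\le\beta\}$. On the strip this extension satisfies the complexified equations, obtained from (2) by replacing every $\|u\|^2$ by $u^Tu$ and using principal branches of the powers, and takes its values where these branches are holomorphic; it is the only such holomorphic solution on the strip with initial value $(q^0,v^0)$. (b) Hence $s$ is a uniform global time-renormalization of (1) with parameter $\beta$. That is, $s$ is real-analytic on $(\mathbb R^{3N}\setminus\Delta)\times\mathbb R^{3N}$, and for all $q^0\in\mathbb R^{3N}\setminus\Delta$ and $v^0\in\mathbb R^{3N}$ the following holds. Let $(q,v):(t_a,t_b)\to(\mathbb R^{3N}\setminus\Delta)\times\mathbb R^{3N}$ be the maximal solution of (1) with $q(0)=q^0$, $v(0)=v^0$. Then $\theta(t)=\int_0^t s(q(t'),v(t'))^{-1}\,dt'$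 maps $(t_a,t_b)$ bijectively onto $\mathbb R$, and the function $(\hat q,\hat v)$ on $\mathbb R$ given by $(\hat q(\theta(t)),\hat v(\theta(t)))=(q(t),v(t))$ extends holomorphically to the strip $\{|\mathrm{Im}\,\tau|\le\beta\}$. -/

import Mathlib

open Set MeasureTheory

noncomputable section

namespace NBody

/-- Positions (or velocities) of `N` bodies in `ℝ³`. -/
abbrev Config (N : ℕ) : Type := Fin N → EuclideanSpace ℝ (Fin 3)

/-- Complex positions (or velocities) of `N` bodies, i.e. elements of `ℂ^{3N}`. -/
abbrev CConfig (N : ℕ) : Type := Fin N → EuclideanSpace ℂ (Fin 3)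

/-- The inclusion `ℝ^{3N} ⊆ ℂ^{3N}`. -/
def toComplex {N : ℕ} (q : Config N) : CConfig N :=
  fun i => WithLp.toLp 2 fun k => ((q i k : ℝ) : ℂ)

/-- The collision set `Δ`. -/
def collisionSet (N : ℕ) : Set (Config N) := {q | ∃ i j, i ≠ j ∧ q i = q j}

variable {N : ℕ}

/-- The gravitational acceleration of the `i`-th body. -/
def accel (G : ℝ) (m : Fin N → ℝ) (q : Config N) : Config N :=
  fun i => ∑ j ∈ Finset.univ.erase i, (G * m j / ‖q i - q j‖ ^ 3) • (q j - q i)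

/-- `K_i(q) = ∑_{k ≠ i} G m_k / ‖q_i - q_k‖²`. -/
def K (G : ℝ) (m : Fin N → ℝ) (q : Config N) (i : Fin N) : ℝ :=
  ∑ k ∈ Finset.univ.erase i, G * m k / ‖q i - q k‖ ^ 2

/-- The quantity `s(q,v)⁻²`; the sums run over the pairs `i < j`. -/
def sInvSq (G : ℝ) (m : Fin N → ℝ) (q v : Config N) : ℝ :=
  (∑ i, ∑ j ∈ Finset.Ioi i, ‖v i - v j‖ ^ 2 / ‖q i - q j‖ ^ 2) +
    ∑ i, ∑ j ∈ Finset.Ioi i, (K G m q i + K G m q j) / ‖q i - q j‖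

/-- The time-renormalization function `s(q,v)`. -/
def s (G : ℝ) (m : Fin N → ℝ) (q v : Config N) : ℝ :=
  sInvSq G m q v ^ (-(1 / 2) : ℝ)

/-! ### Solutions for real time -/

/-- `(q,v)` solves the `N`-body equations, without collisions, at all times in `I`. -/
def IsSolutionOn (G : ℝ) (m : Fin N → ℝ) (I : Set ℝ) (q v : ℝ → Config N) : Prop :=
  ∀ t ∈ I, q t ∉ collisionSet N ∧ HasDerivAt q (v t) t ∧ HasDerivAt v (accel G m (q t)) t

/-- `(q,v)` on the open interval `I` is the maximal solution of the `N`-body equations with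
`q(0) = q⁰`, `v(0) = v⁰`. -/
structure IsMaximalSolution (G : ℝ) (m : Fin N → ℝ) (q₀ v₀ : Config N)
    (I : Set ℝ) (q v : ℝ → Config N) : Prop where
  isOpen : IsOpen I
  ordConnected : I.OrdConnected
  zero_mem : (0 : ℝ) ∈ I
  q_zero : q 0 = q₀
  v_zero : v 0 = v₀
  isSolutionOn : IsSolutionOn G m I q v
  maximal : ∀ (J : Set ℝ) (q' v' : ℝ → Config N), IsOpen J → J.OrdConnected → I ⊆ J →
    IsSolutionOn G m J q' v' → EqOn q' q I → EqOn v' v I → J = I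

/-- The fictitious time `θ(t) = ∫₀ᵗ s(q(t'),v(t'))⁻¹ dt'`. -/
def fictitiousTime (σ : Config N → Config N → ℝ) (q v : ℝ → Config N) (t : ℝ) : ℝ :=
  ∫ t' in (0 : ℝ)..t, (σ (q t') (v t'))⁻¹

/-- `(q,v)` solves, without collisions, the `N`-body equations renormalized by `σ`
at all fictitious times in `I`. -/
def IsRenormSolutionOn (G : ℝ) (m : Fin N → ℝ) (σ : Config N → Config N → ℝ)
    (I : Set ℝ) (q v : ℝ → Config N) : Prop :=
  ∀ τ ∈ I, q τ ∉ collisionSet N ∧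
    HasDerivAt q (σ (q τ) (v τ) • v τ) τ ∧
    HasDerivAt v (σ (q τ) (v τ) • accel G m (q τ)) τ

/-! ### The complexified renormalized equations

The right-hand sides are extended to complex arguments by writing `‖u‖²` as `uᵀu` and taking the
principal branches of the powers. -/

/-- `(q_i - q_j)ᵀ(q_i - q_j)` (bilinear, no conjugation). -/
def pairSq (q : CConfig N) (i j : Fin N) : ℂ := ∑ k, (q i k - q j k) ^ 2

def accelC (G : ℝ) (m : Fin N → ℝ) (q : CConfig N) : CConfig N :=
  fun i => ∑ j ∈ Finset.univ.erase i,
    ((G * m j : ℂ) / pairSq q i j ^ (3 / 2 : ℂ)) • (q j - q i)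

def KC (G : ℝ) (m : Fin N → ℝ) (q : CConfig N) (i : Fin N) : ℂ :=
  ∑ k ∈ Finset.univ.erase i, (G * m k : ℂ) / pairSq q i k

def sInvSqC (G : ℝ) (m : Fin N → ℝ) (q v : CConfig N) : ℂ :=
  (∑ i, ∑ j ∈ Finset.Ioi i, pairSq v i j / pairSq q i j) +
    ∑ i, ∑ j ∈ Finset.Ioi i, (KC G m q i + KC G m q j) / pairSq q i j ^ (1 / 2 : ℂ)

def sC (G : ℝ) (m : Fin N → ℝ) (q v : CConfig N) : ℂ :=
  sInvSqC G m q v ^ (-(1 / 2) : ℂ)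

/-- The domain on which the principal branches above are holomorphic. -/
def complexDomain (G : ℝ) (m : Fin N → ℝ) : Set (CConfig N × CConfig N) :=
  {p | (∀ i j, i ≠ j → pairSq p.1 i j ∈ Complex.slitPlane) ∧
    sInvSqC G m p.1 p.2 ∈ Complex.slitPlane}

/-- `(Q,V)` is a holomorphic solution, on (a neighbourhood of) `S ⊆ ℂ`, of the complexified
`N`-body equations renormalized by `s`. -/
def IsHolomorphicRenormSolutionOn (G : ℝ) (m : Fin N → ℝ) (S : Set ℂ)
    (Q V : ℂ → CConfig N) : Prop :=
  AnalyticOnNhd ℂ Q S ∧ AnalyticOnNhd ℂ V S ∧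
  ∀ τ ∈ S, (Q τ, V τ) ∈ complexDomain G m ∧
    HasDerivAt Q (sC G m (Q τ) (V τ) • V τ) τ ∧
    HasDerivAt V (sC G m (Q τ) (V τ) • accelC G m (Q τ)) τ

/-! ### Uniform global time-renormalizations -/

/-- The closed strip `|Im τ| ≤ β`. -/
def strip (β : ℝ) : Set ℂ := {τ | |τ.im| ≤ β}

/-- `(Q,V)` is a holomorphic extension of `(q,v)`, defined on `ℝ`, to the closed strip
`|Im τ| ≤ β` (holomorphic on a neighbourhood of the strip). -/
def IsHolomorphicExtension (β : ℝ) (q v : ℝ → Config N) (Q V : ℂ → CConfig N) : Prop :=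
  AnalyticOnNhd ℂ Q (strip β) ∧ AnalyticOnNhd ℂ V (strip β) ∧
  ∀ τ : ℝ, Q τ = toComplex (q τ) ∧ V τ = toComplex (v τ)

/-- `σ` is a uniform global time-renormalization of the `N`-body equations with parameter `β`:
it is real-analytic off collisions, and for every non-collision initial datum the associated
fictitious time runs over all of `ℝ` along the maximal solution, and the solution expressed in
fictitious time extends holomorphically to the strip `|Im τ| ≤ β`. -/
def IsUniformGlobalTimeRenormalization (G : ℝ) (m : Fin N → ℝ)
    (σ : Config N → Config N → ℝ) (β : ℝ) : Prop :=
  0 < β ∧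
  AnalyticOnNhd ℝ (fun p : Config N × Config N => σ p.1 p.2) {p | p.1 ∉ collisionSet N} ∧
  ∀ q₀ v₀ : Config N, q₀ ∉ collisionSet N →
    ∃ (I : Set ℝ) (q v : ℝ → Config N), IsMaximalSolution G m q₀ v₀ I q v ∧
      BijOn (fictitiousTime σ q v) I univ ∧
      ∃ qh vh : ℝ → Config N,
        (∀ t ∈ I, qh (fictitiousTime σ q v t) = q t ∧ vh (fictitiousTime σ q v t) = v t) ∧
        ∃ Q V : ℂ → CConfig N, IsHolomorphicExtension β qh vh Q V

end NBody

end

/-! Around each real state `(q, v)` the complexified field of (2) is bounded on a neighbourhood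
scaled by the state itself, `nearStates`: each difference `q i - q j` may move by 1/16 of the
distance `r` of the pair, each `v i` by `2/25 * s * K i`. The sum `s⁻²` dominates the term of every
pair, so `s * ‖v i - v j‖ ≤ r` and `s ^ 2 * (K i + K j) ≤ r` (`s_mul_pair_le`). Hence on this
neighbourhood `s⁻²` changes by at most 7/16 of its value (`norm_sInvSqC_sub_le`), the principal
branches stay holomorphic, and `|s|` grows by at most the factor 4/3. The differences of positions
then have speed at most `4/3 * r`, and the velocities have speed at most `16/9 * s * K i`. The
numerical constants do not depend on `N`, `G`, the masses or the state.

Over a complex time of modulus below 9/200 the displacements are therefore at most `3/50 * r ≤ 1/16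
* r` and `2/25 * s * K i`. Picard iterates cannot leave the neighbourhood, so from every real state
a holomorphic solution exists on the disc of radius 9/200 (`exists_disc_solution`). This number
exceeds β.

The uniform radius gives the rest of (a). On the real axis it is a uniform existence time, hence
solutions are global (`ODE_exists_global`). The discs centred at all real times glue to a solution
on `|Im τ| < 9/200` (`exists_strip_extension`). Uniqueness is ODE uniqueness on the real axis
followed by the identity theorem.

For (b), physical time is the integral of `s` along the global solution, a strictly increasing
function of fictitious time with inverse θ. Its range is the maximal interval: if the solution
continued past an endpoint, `s⁻¹` would be bounded up to there, and so would θ, which however takes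
all real values. -/

noncomputable section

/-! ### Autonomous real ODEs: uniqueness and continuation -/

section RealODE

open Filter Topology

variable {E : Type*} [NormedAddCommGroup E] [NormedSpace ℝ E] {F : E → E} {U : Set E}

/-- Two solutions of an autonomous ODE on an open interval, one of which stays in a region where
the vector field is `C¹`, agree if they agree at one time. -/
theorem ODE_eqOn_of_isPreconnected (hF : ∀ x ∈ U, ContDiffAt ℝ 1 F x) {J : Set ℝ}
    (hJo : IsOpen J) (hJ : IsPreconnected J) {f g : ℝ → E}
    (hf : ∀ t ∈ J, f t ∈ U ∧ HasDerivAt f (F (f t)) t)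
    (hg : ∀ t ∈ J, HasDerivAt g (F (g t)) t) {t₀ : ℝ} (ht₀ : t₀ ∈ J) (h : f t₀ = g t₀) :
    EqOn f g J := by
  have key : ∀ t ∈ J, f t = g t → f =ᶠ[𝓝 t] g := by
    intro t ht hfg
    obtain ⟨K, s, hs, hL⟩ := (hF _ (hf t ht).1).exists_lipschitzOnWith
    have hJt : ∀ᶠ u in 𝓝 t, u ∈ J := hJo.mem_nhds ht
    refine ODE_solution_unique_of_eventually (v := fun _ => F) (s := fun _ => s) (K := K)
      (Eventually.of_forall fun _ => hL) ?_ ?_ hfg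
    -- Only `f` is known to lie in `U`. Where the two curves meet, `g` is in the same Lipschitz
    -- neighbourhood by continuity.
    · filter_upwards [hJt, (hf t ht).2.continuousAt.preimage_mem_nhds hs] with u hu hus
      exact ⟨(hf u hu).2, hus⟩
    · rw [hfg] at hs
      filter_upwards [hJt, (hg t ht).continuousAt.preimage_mem_nhds hs] with u hu hus
      exact ⟨hg u hu, hus⟩
  -- The set of times of local agreement is open by construction. It is closed in `J` since
  -- agreement at a limit time, given by continuity, spreads to a neighbourhood by `key`.
  have hsub : J ⊆ {t | f =ᶠ[𝓝 t] g} := by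
    refine hJ.subset_of_closure_inter_subset isOpen_setOfPred_eventually_nhds
      ⟨t₀, ht₀, key t₀ ht₀ h⟩ ?_
    rintro t ⟨htc, htJ⟩
    refine key t htJ ?_
    have hfr : ∃ᶠ u in 𝓝 t, f u = g u :=
      (mem_closure_iff_frequently.mp htc).mono fun u hu => EventuallyEq.eq_of_nhds hu
    by_contra hne
    have := ((hf t htJ).2.continuousAt.prodMk (hg t htJ).continuousAt).eventually
      (isClosed_diagonal.isOpen_compl.mem_nhds (x := (f t, g t)) hne)
    exact hfr (this.mono fun u hu => hu)
  exact fun t ht => EventuallyEq.eq_of_nhds (hsub ht)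

/-- A solution on `(-T, T)` can be extended by any amount smaller than a uniform existence time. -/
theorem ODE_extend (hF : ∀ x ∈ U, ContDiffAt ℝ 1 F x) {ρ : ℝ} (hρ : 0 < ρ)
    (hloc : ∀ x ∈ U, ∃ y : ℝ → E, y 0 = x ∧
      ∀ t ∈ Ioo (-ρ) ρ, y t ∈ U ∧ HasDerivAt y (F (y t)) t)
    {T : ℝ} (hT : ρ / 2 ≤ T) {y : ℝ → E}
    (hy : ∀ t ∈ Ioo (-T) T, y t ∈ U ∧ HasDerivAt y (F (y t)) t) :
    ∃ y' : ℝ → E, y' 0 = y 0 ∧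
      ∀ t ∈ Ioo (-(T + ρ / 2)) (T + ρ / 2), y' t ∈ U ∧ HasDerivAt y' (F (y' t)) t := by
  -- Restarting at `±a`, a quarter of `ρ` before the ends, reaches `T + 3 * ρ / 4`, beyond the
  -- required `T + ρ / 2`. The bound `ρ / 2 ≤ T` makes `a` positive, so time `0` lies in the middle
  -- piece.
  obtain ⟨a, ha⟩ : ∃ a, a = T - ρ / 4 := ⟨_, rfl⟩
  have hstep : ∀ b, b ∈ Ioo (-T) T → ∃ γ : ℝ → E,
      (∀ t ∈ Ioo (b - ρ) (b + ρ), γ t ∈ U ∧ HasDerivAt γ (F (γ t)) t) ∧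
      EqOn y γ (Ioo (-T) T ∩ Ioo (b - ρ) (b + ρ)) := by
    intro b hb
    obtain ⟨γ, hγ0, hγ⟩ := hloc (y b) (hy b hb).1
    have h1 : ∀ t ∈ Ioo (b - ρ) (b + ρ),
        γ (t - b) ∈ U ∧ HasDerivAt (fun t => γ (t - b)) (F (γ (t - b))) t := by
      intro t ht
      obtain ⟨h1, h2⟩ := hγ (t - b) ⟨by linarith [ht.1], by linarith [ht.2]⟩
      exact ⟨h1, by simpa using h2.comp_sub_const t b⟩
    refine ⟨fun t => γ (t - b), h1, ?_⟩
    refine ODE_eqOn_of_isPreconnected hF (isOpen_Ioo.inter isOpen_Ioo) ?_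
      (fun t ht => hy t ht.1) (fun t ht => (h1 t ht.2).2) (t₀ := b)
      ⟨hb, by constructor <;> linarith⟩ (by simp [hγ0])
    exact (ordConnected_Ioo.inter ordConnected_Ioo).isPreconnected
  obtain ⟨γ, hγ, hγe⟩ := hstep a ⟨by linarith, by linarith⟩
  obtain ⟨δ, hδ, hδe⟩ := hstep (-a) ⟨by linarith, by linarith⟩
  let z : ℝ → E := fun t => if t < -a then δ t else if t ≤ a then y t else γ t
  have ey : EqOn z y (Ioo (-T) T) := by
    intro t ht
    simp only [z]
    split_ifs with h1 h2
    · exact (hδe ⟨ht, by linarith [ht.1], by linarith⟩).symm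
    · rfl
    · exact (hγe ⟨ht, by linarith, by linarith [ht.2]⟩).symm
  have eγ : EqOn z γ (Ioi a) := by
    intro t ht
    have ht' : a < t := ht
    simp only [z]
    rw [if_neg (by linarith), if_neg (by linarith)]
  have eδ : EqOn z δ (Iio (-a)) := by
    intro t ht
    have ht' : t < -a := ht
    simp only [z]
    rw [if_pos ht']
  have transfer : ∀ {w : ℝ → E} {S : Set ℝ} {t : ℝ}, IsOpen S → EqOn z w S → t ∈ S →
      w t ∈ U ∧ HasDerivAt w (F (w t)) t → z t ∈ U ∧ HasDerivAt z (F (z t)) t := by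
    intro w S t hS hzw ht hw
    rw [hzw ht]
    exact ⟨hw.1, hw.2.congr_of_eventuallyEq (hzw.eventuallyEq_of_mem (hS.mem_nhds ht))⟩
  refine ⟨z, ey ⟨by linarith, by linarith⟩, fun t ht => ?_⟩
  rcases lt_or_ge t (-a) with h1 | h1
  · exact transfer isOpen_Iio eδ h1 (hδ t ⟨by linarith [ht.1], by linarith⟩)
  rcases lt_or_ge a t with h2 | h2
  · exact transfer isOpen_Ioi eγ h2 (hγ t ⟨by linarith, by linarith [ht.2]⟩)
  have h3 : t ∈ Ioo (-T) T := ⟨by linarith, by linarith⟩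
  exact transfer isOpen_Ioo ey h3 (hy t h3)

/-- An autonomous ODE with a uniform existence time has global solutions. -/
theorem ODE_exists_global (hF : ∀ x ∈ U, ContDiffAt ℝ 1 F x) {ρ : ℝ} (hρ : 0 < ρ)
    (hloc : ∀ x ∈ U, ∃ y : ℝ → E, y 0 = x ∧
      ∀ t ∈ Ioo (-ρ) ρ, y t ∈ U ∧ HasDerivAt y (F (y t)) t) {x : E} (hx : x ∈ U) :
    ∃ y : ℝ → E, y 0 = x ∧ ∀ t, y t ∈ U ∧ HasDerivAt y (F (y t)) t := by
  let T : ℕ → ℝ := fun n => (n + 1) * (ρ / 2)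
  have hTpos : ∀ n, 0 < T n := fun n => by positivity
  have hex : ∀ n : ℕ, ∃ y : ℝ → E, y 0 = x ∧
      ∀ t ∈ Ioo (-T n) (T n), y t ∈ U ∧ HasDerivAt y (F (y t)) t := by
    intro n
    induction n with
    | zero =>
      obtain ⟨y, h0, hy⟩ := hloc x hx
      refine ⟨y, h0, fun t ht => hy t ?_⟩
      simp only [T, mem_Ioo] at ht
      push_cast at ht
      constructor <;> linarith [ht.1, ht.2]
    | succ n ih =>
      obtain ⟨y, h0, hy⟩ := ih
      have hT : ρ / 2 ≤ T n := by
        simp only [T]; nlinarith [(n.cast_nonneg : (0 : ℝ) ≤ n)]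
      obtain ⟨z, hz0, hz⟩ := ODE_extend hF hρ hloc hT hy
      refine ⟨z, hz0.trans h0, fun t ht => hz t ?_⟩
      have : T (n + 1) = T n + ρ / 2 := by simp only [T]; push_cast; ring
      rwa [this] at ht
  choose y hy0 hy using hex
  have agree : ∀ m n, m ≤ n → EqOn (y m) (y n) (Ioo (-T m) (T m)) := by
    intro m n hmn
    have hTT : T m ≤ T n := by
      simp only [T]
      have : (m : ℝ) ≤ n := by exact_mod_cast hmn
      nlinarith
    exact ODE_eqOn_of_isPreconnected hF isOpen_Ioo ordConnected_Ioo.isPreconnected (hy m)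
      (fun t ht => (hy n t ⟨by linarith [ht.1], by linarith [ht.2]⟩).2)
      (t₀ := 0) ⟨by linarith [hTpos m], hTpos m⟩ ((hy0 m).trans (hy0 n).symm)
  have hN : ∀ t : ℝ, ∃ n : ℕ, t ∈ Ioo (-T n) (T n) := by
    intro t
    obtain ⟨n, hn⟩ := exists_nat_gt (|t| / (ρ / 2))
    refine ⟨n, abs_lt.mp ?_⟩
    rw [div_lt_iff₀ (by positivity)] at hn
    simp only [T]; nlinarith
  choose ν hν using hN
  have hz : ∀ n, EqOn (fun t => y (ν t) t) (y n) (Ioo (-T n) (T n)) := by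
    intro n t ht
    rcases le_total (ν t) n with h | h
    · exact agree _ _ h (hν t)
    · exact (agree _ _ h ht).symm
  refine ⟨fun t => y (ν t) t, hy0 _, fun t => ⟨(hy _ t (hν t)).1, ?_⟩⟩
  exact (hy _ t (hν t)).2.congr_of_eventuallyEq
    ((hz _).eventuallyEq_of_mem (isOpen_Ioo.mem_nhds (hν t)))

end RealODE

/-! ### Gluing of holomorphic functions and holomorphic Picard iteration -/

section Holomorphic

open Filter Topology Metric

variable {E : Type*} [NormedAddCommGroup E] [NormedSpace ℂ E]

theorem frequently_eq_of_eventually_ofReal {E : Type*} {f g : ℂ → E} {b : ℝ}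
    (h : ∀ᶠ t : ℝ in 𝓝 b, f t = g t) : ∃ᶠ z in 𝓝[≠] (b : ℂ), f z = g z := by
  have hT : Tendsto (fun t : ℝ => (t : ℂ)) (𝓝[≠] b) (𝓝[≠] (b : ℂ)) := by
    refine tendsto_nhdsWithin_of_tendsto_nhds_of_eventually_within _
      (Complex.continuous_ofReal.continuousAt.tendsto.mono_left nhdsWithin_le_nhds) ?_
    filter_upwards [self_mem_nhdsWithin] with t ht
    simpa using ht
  exact hT.frequently (h.filter_mono nhdsWithin_le_nhds).frequently

/-- Functions holomorphic on discs of a common radius centred at the real points, compatible on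
the real line, glue to a function on the strip. -/
theorem exists_glue_discs [CompleteSpace E] {R : ℝ} {Y : ℝ → ℂ → E} {y : ℝ → E}
    (hY : ∀ a, DifferentiableOn ℂ (Y a) (ball (a : ℂ) R))
    (hy : ∀ a t : ℝ, |t - a| < R → Y a t = y t) :
    ∃ W : ℂ → E, ∀ a : ℝ, EqOn W (Y a) (ball (a : ℂ) R) := by
  -- Each point uses the disc centred at its real part `b`. If `z` is in the disc about `a`, so is
  -- `b`; the intersection of the two discs is convex and contains real points near `b`, where both
  -- functions equal `y`. The identity theorem applies.
  refine ⟨fun z => Y z.re z, fun a z hz => ?_⟩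
  rw [mem_ball, dist_eq_norm] at hz
  set b := z.re with hb
  have hbb : ‖(z - b : ℂ)‖ < R := by
    refine lt_of_le_of_lt ?_ hz
    have e : (z - b : ℂ) = ((z - a).im : ℂ) * Complex.I := by
      apply Complex.ext <;> simp [hb]
    rw [e, norm_mul, Complex.norm_I, mul_one, Complex.norm_real]
    exact Complex.abs_im_le_norm _
  have hba : |b - a| < R := by
    refine lt_of_le_of_lt ?_ hz
    simpa [hb] using Complex.abs_re_le_norm (z - a)
  have hR : 0 < R := (norm_nonneg _).trans_lt hz
  have h1 : AnalyticOnNhd ℂ (Y b) (ball (b : ℂ) R ∩ ball (a : ℂ) R) :=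
    ((hY b).analyticOnNhd isOpen_ball).mono inter_subset_left
  have h2 : AnalyticOnNhd ℂ (Y a) (ball (b : ℂ) R ∩ ball (a : ℂ) R) :=
    ((hY a).analyticOnNhd isOpen_ball).mono inter_subset_right
  refine h1.eqOn_of_preconnected_of_frequently_eq h2
    ((convex_ball _ _).inter (convex_ball _ _)).isPreconnected (z₀ := (b : ℂ)) ?_
    (frequently_eq_of_eventually_ofReal ?_) ?_
  · refine ⟨mem_ball_self hR, ?_⟩
    rw [mem_ball, dist_eq_norm, ← Complex.ofReal_sub, Complex.norm_real]
    exact hba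
  · have c1 : ∀ᶠ t : ℝ in 𝓝 b, |t - b| < R := by
      refine (by fun_prop : ContinuousAt (fun t : ℝ => |t - b|) b).eventually_lt
        continuousAt_const ?_
      simpa using hR
    have c2 : ∀ᶠ t : ℝ in 𝓝 b, |t - a| < R :=
      (by fun_prop : ContinuousAt (fun t : ℝ => |t - a|) b).eventually_lt
        continuousAt_const hba
    filter_upwards [c1, c2] with t h1 h2
    rw [hy b t h1, hy a t h2]
  · refine ⟨?_, ?_⟩ <;> rw [mem_ball, dist_eq_norm] <;> assumption

/-- Integration along the segment from `0` to `z`. The gained factor `1 / (n + 1)` builds the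
factorials in the Picard estimate. -/
theorem norm_le_of_norm_deriv_le_mul_pow {R : ℝ} {h h' : ℂ → E} {C : ℝ} {n : ℕ} (h0 : h 0 = 0)
    (hd : ∀ z ∈ ball (0 : ℂ) R, HasDerivAt h (h' z) z)
    (hb : ∀ z ∈ ball (0 : ℂ) R, ‖h' z‖ ≤ C * ‖z‖ ^ n) {z : ℂ} (hz : z ∈ ball (0 : ℂ) R) :
    ‖h z‖ ≤ C * ‖z‖ ^ (n + 1) / (n + 1) := by
  have hmem : ∀ t ∈ Icc (0 : ℝ) 1, (t : ℂ) * z ∈ ball (0 : ℂ) R := by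
    intro t ht
    rw [mem_ball_zero_iff] at hz ⊢
    rw [norm_mul, Complex.norm_real, Real.norm_of_nonneg ht.1]
    nlinarith [norm_nonneg z, ht.2]
  have hder : ∀ t ∈ Icc (0 : ℝ) 1, HasDerivAt (fun t : ℝ => h (t * z)) (z • h' (t * z)) t := by
    intro t ht
    have := (hd _ (hmem t ht)).scomp t (((hasDerivAt_id t).ofReal_comp).mul_const z)
    simpa [Function.comp_def] using this
  have := image_norm_le_of_norm_deriv_right_le_deriv_boundary (a := 0) (b := 1)
    (f := fun t : ℝ => h (t * z)) (f' := fun t : ℝ => z • h' (t * z))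
    (B := fun t => C * ‖z‖ ^ (n + 1) / (n + 1) * t ^ (n + 1))
    (B' := fun t => C * ‖z‖ ^ (n + 1) * t ^ n)
    (fun t ht => (hder t ht).continuousAt.continuousWithinAt)
    (fun t ht => (hder t ⟨ht.1, ht.2.le⟩).hasDerivWithinAt) (by simp [h0])
    (fun t => by
      have h := (hasDerivAt_pow (n + 1) t).const_mul (C * ‖z‖ ^ (n + 1) / (n + 1))
      have : (n + 1 : ℝ) ≠ 0 := by positivity
      rwa [Nat.add_sub_cancel, ← mul_assoc, Nat.cast_add_one, div_mul_cancel₀ _ this] at h)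
    (fun t ht => by
      have hh := hb _ (hmem t ⟨ht.1, ht.2.le⟩)
      rw [norm_mul, Complex.norm_real, Real.norm_of_nonneg ht.1, mul_pow] at hh
      calc ‖z • h' (t * z)‖ = ‖z‖ * ‖h' (t * z)‖ := norm_smul _ _
        _ ≤ ‖z‖ * (C * (t ^ n * ‖z‖ ^ n)) := by gcongr
        _ = C * ‖z‖ ^ (n + 1) * t ^ n := by ring)
    (right_mem_Icc.mpr zero_le_one)
  simpa using this

/-- Picard iteration for a holomorphic ODE on a disc, with values constrained to closed sets `D z`
that are invariant under the iteration. -/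
theorem exists_holomorphic_solution_of_invariant [CompleteSpace E] {R : ℝ} {F : E → E}
    {D₀ : Set E} {D : ℂ → Set E} {K : NNReal} {y₀ : E} (hDcl : ∀ z, IsClosed (D z))
    (hDD : ∀ z, D z ⊆ D₀) (hL : LipschitzOnWith K F D₀) (hFd : ∀ y ∈ D₀, DifferentiableAt ℂ F y)
    (hy₀ : ∀ z, y₀ ∈ D z)
    (hinv : ∀ g : ℂ → E, g 0 = y₀ →
      (∀ z ∈ ball (0 : ℂ) R, ∃ y ∈ D z, HasDerivAt g (F y) z) → ∀ z ∈ ball (0 : ℂ) R, g z ∈ D z) :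
    ∃ y : ℂ → E, y 0 = y₀ ∧ ∀ z ∈ ball (0 : ℂ) R, y z ∈ D z ∧ HasDerivAt y (F (y z)) z := by
  let P : (ℂ → E) → Prop := fun f =>
    f 0 = y₀ ∧ DifferentiableOn ℂ f (ball 0 R) ∧ ∀ z ∈ ball (0 : ℂ) R, f z ∈ D z
  have hnext : ∀ f : {f // P f}, ∃ g : {g // P g},
      ∀ z ∈ ball (0 : ℂ) R, HasDerivAt g.1 (F (f.1 z)) z := by
    rintro ⟨f, hf0, hfd, hfD⟩
    have hd : DifferentiableOn ℂ (fun z => F (f z)) (ball 0 R) := fun z hz =>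
      ((hFd _ (hDD z (hfD z hz))).comp z
        (hfd.differentiableAt (isOpen_ball.mem_nhds hz))).differentiableWithinAt
    -- The Picard integral is replaced by a holomorphic primitive on the disc.
    obtain ⟨g, hg0, hg⟩ := hd.isExactOn_ball.with_val_at 0 y₀
    exact ⟨⟨g, hg0, fun z hz => (hg z hz).differentiableAt.differentiableWithinAt,
      hinv g hg0 fun z hz => ⟨f z, hfD z hz, hg z hz⟩⟩, hg⟩
  choose next hnextD using hnext
  let Y : ℕ → {f // P f} := fun n =>
    Nat.rec ⟨fun _ => y₀, rfl, differentiableOn_const _, fun z _ => hy₀ z⟩ (fun _ f => next f) n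
  let y : ℕ → ℂ → E := fun n => (Y n).1
  have hyP : ∀ n, P (y n) := fun n => (Y n).2
  have hyd : ∀ n, ∀ z ∈ ball (0 : ℂ) R, HasDerivAt (y (n + 1)) (F (y n z)) z :=
    fun n => hnextD (Y n)
  have hLip : ∀ m n, ∀ z ∈ ball (0 : ℂ) R, ‖F (y m z) - F (y n z)‖ ≤ K * ‖y m z - y n z‖ := by
    intro m n z hz
    exact hL.norm_sub_le (hDD z ((hyP m).2.2 z hz)) (hDD z ((hyP n).2.2 z hz))
  -- The factorial makes the series of increments converge for every `R` and `K`; no contraction is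
  -- needed.
  have hbound : ∀ n : ℕ, ∀ z ∈ ball (0 : ℂ) R,
      ‖y (n + 1) z - y n z‖ ≤ ‖F y₀‖ * K ^ n / (n + 1).factorial * ‖z‖ ^ (n + 1) := by
    intro n
    induction n with
    | zero =>
      intro z hz
      have := norm_le_of_norm_deriv_le_mul_pow (h := fun z => y 1 z - y 0 z)
        (h' := fun z => F (y 0 z)) (C := ‖F y₀‖) (n := 0)
        (by simp [(hyP 1).1, (hyP 0).1])
        (fun z hz => by simpa [y, Y] using (hyd 0 z hz).sub_const y₀)
        (fun z hz => by simp [y, Y]) hz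
      simpa using this
    | succ n ih =>
      intro z hz
      have := norm_le_of_norm_deriv_le_mul_pow (h := fun z => y (n + 2) z - y (n + 1) z)
        (h' := fun z => F (y (n + 1) z) - F (y n z))
        (C := K * (‖F y₀‖ * K ^ n / (n + 1).factorial)) (n := n + 1)
        (by simp [(hyP (n + 2)).1, (hyP (n + 1)).1])
        (fun z hz => (hyd (n + 1) z hz).sub (hyd n z hz))
        (fun z hz => by
          refine (hLip (n + 1) n z hz).trans ?_
          rw [mul_assoc]
          exact mul_le_mul_of_nonneg_left (ih z hz) K.2) hz
      refine this.trans_eq ?_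
      rw [Nat.factorial_succ (n + 1)]
      have : ((n + 1).factorial : ℝ) ≠ 0 := by positivity
      have : (n + 1 + 1 : ℝ) ≠ 0 := by positivity
      push_cast
      field_simp
      ring
  have hsum : Summable fun n : ℕ => ‖F y₀‖ * R * ((K * R) ^ n / n.factorial) :=
    (Real.summable_pow_div_factorial _).mul_left _
  have hb' : ∀ n : ℕ, ∀ z ∈ ball (0 : ℂ) R,
      ‖y (n + 1) z - y n z‖ ≤ ‖F y₀‖ * R * ((K * R) ^ n / n.factorial) := by
    intro n z hz
    refine (hbound n z hz).trans ?_
    rw [mem_ball_zero_iff] at hz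
    have hR : 0 ≤ R := (norm_nonneg z).trans hz.le
    calc ‖F y₀‖ * K ^ n / (n + 1).factorial * ‖z‖ ^ (n + 1)
        ≤ ‖F y₀‖ * K ^ n / n.factorial * R ^ (n + 1) := by
          gcongr
          exact n.le_succ
      _ = ‖F y₀‖ * R * ((K * R) ^ n / n.factorial) := by rw [mul_pow]; ring
  have hunif := tendstoUniformlyOn_tsum_nat hsum hb'
  let φ : ℂ → E := fun z => ∑' n, (y (n + 1) z - y n z)
  have hsumy : ∀ n z, ∑ k ∈ Finset.range n, (y (k + 1) z - y k z) = y n z - y₀ := by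
    intro n z
    exact Finset.sum_range_sub (fun k => y k z) n
  have hlim : TendstoUniformlyOn (fun n z => y n z) (fun z => y₀ + φ z) atTop (ball 0 R) := by
    rw [Metric.tendstoUniformlyOn_iff] at hunif ⊢
    intro ε hε
    filter_upwards [hunif ε hε] with n hn z hz
    have := hn z hz
    rw [hsumy, dist_eq_norm] at this
    rw [dist_eq_norm]
    convert this using 2
    simp only [φ]
    abel
  let w : ℂ → E := fun z => y₀ + φ z
  have hloc := hlim.tendstoLocallyUniformlyOn
  have hev : ∀ᶠ n : ℕ in atTop, DifferentiableOn ℂ (fun z => y n z) (ball 0 R) :=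
    Eventually.of_forall fun n => (hyP n).2.1
  have hwd : DifferentiableOn ℂ w (ball 0 R) := hloc.differentiableOn hev isOpen_ball
  have hwD : ∀ z ∈ ball (0 : ℂ) R, w z ∈ D z := fun z hz =>
    (hDcl z).mem_of_tendsto (hlim.tendsto_at hz) (Eventually.of_forall fun n => (hyP n).2.2 z hz)
  refine ⟨w, ?_, fun z hz => ⟨hwD z hz, ?_⟩⟩
  · have : ∀ n, y (n + 1) 0 - y n 0 = 0 := fun n => by simp [(hyP n).1, (hyP (n + 1)).1]
    simp [w, φ, this]
  · have h1 : HasDerivAt w (deriv w z) z :=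
      (hwd.differentiableAt (isOpen_ball.mem_nhds hz)).hasDerivAt
    -- By Weierstrass the derivatives converge as well, so the recursion passes to the limit.
    have h2 : Tendsto (fun n => deriv (y (n + 1)) z) atTop (𝓝 (deriv w z)) :=
      ((hloc.deriv hev isOpen_ball).tendsto_at hz).comp (tendsto_add_atTop_nat 1)
    have h3 : Tendsto (fun n => F (y n z)) atTop (𝓝 (F (w z))) :=
      ((hFd _ (hDD z (hwD z hz))).continuousAt.tendsto).comp (hlim.tendsto_at hz)
    have h4 : (fun n => deriv (y (n + 1)) z) = fun n => F (y n z) :=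
      funext fun n => (hyd n z hz).deriv
    rw [h4] at h2
    rwa [tendsto_nhds_unique h2 h3] at h1

end Holomorphic

namespace NBody

open scoped ContDiff

variable {N : ℕ} {G : ℝ} {m : Fin N → ℝ}

/-! ### The real and the complexified vector field -/

/-- The right-hand side of the renormalized equations. -/
def renormField (G : ℝ) (m : Fin N → ℝ) (p : Config N × Config N) : Config N × Config N :=
  (s G m p.1 p.2 • p.2, s G m p.1 p.2 • accel G m p.1)

/-- The right-hand side of the complexified renormalized equations. -/
def renormFieldC (G : ℝ) (m : Fin N → ℝ) (p : CConfig N × CConfig N) : CConfig N × CConfig N :=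
  (sC G m p.1 p.2 • p.2, sC G m p.1 p.2 • accelC G m p.1)

theorem norm_sub_pos {q : Config N} (hq : q ∉ collisionSet N) {i j : Fin N} (hij : i ≠ j) :
    0 < ‖q i - q j‖ :=
  norm_pos_iff.mpr fun h => hq ⟨i, j, hij, sub_eq_zero.mp h⟩

theorem K_nonneg (hG : 0 < G) (hm : ∀ i, 0 < m i) (q : Config N) (i : Fin N) : 0 ≤ K G m q i :=
  Finset.sum_nonneg fun k _ => by have := hm k; positivity

theorem K_pos (hN : 2 ≤ N) (hG : 0 < G) (hm : ∀ i, 0 < m i) {q : Config N}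
    (hq : q ∉ collisionSet N) (i : Fin N) : 0 < K G m q i := by
  have : Nontrivial (Fin N) := Fin.nontrivial_iff_two_le.mpr hN
  obtain ⟨j, hj⟩ := exists_ne i
  refine Finset.sum_pos (fun k hk => ?_) ⟨j, by simp [hj]⟩
  have := hm k
  have := norm_sub_pos hq (Finset.ne_of_mem_erase hk).symm
  positivity

theorem pairTerm_nonneg (hG : 0 < G) (hm : ∀ i, 0 < m i) (q v : Config N) (i j : Fin N) :
    0 ≤ ‖v i - v j‖ ^ 2 / ‖q i - q j‖ ^ 2 + (K G m q i + K G m q j) / ‖q i - q j‖ := by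
  have := K_nonneg hG hm q i
  have := K_nonneg hG hm q j
  positivity

theorem sInvSq_eq (q v : Config N) : sInvSq G m q v = ∑ i, ∑ j ∈ Finset.Ioi i,
    (‖v i - v j‖ ^ 2 / ‖q i - q j‖ ^ 2 + (K G m q i + K G m q j) / ‖q i - q j‖) := by
  simp only [sInvSq, Finset.sum_add_distrib]

/-- All terms are nonnegative, and the term is symmetric in `i` and `j`. This is the only way in
which the form of `s` bounds a single pair. -/
theorem pairTerm_le_sInvSq (hG : 0 < G) (hm : ∀ i, 0 < m i) (q v : Config N) {i j : Fin N}
    (hij : i ≠ j) :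
    ‖v i - v j‖ ^ 2 / ‖q i - q j‖ ^ 2 + (K G m q i + K G m q j) / ‖q i - q j‖
      ≤ sInvSq G m q v := by
  wlog h : i < j generalizing i j
  · have := this hij.symm (lt_of_le_of_ne (not_lt.mp h) hij.symm)
    rwa [norm_sub_rev (v i), norm_sub_rev (q i), add_comm (K G m q i)]
  rw [sInvSq_eq]
  refine le_trans ?_ (Finset.single_le_sum (f := fun i => ∑ j ∈ Finset.Ioi i,
    (‖v i - v j‖ ^ 2 / ‖q i - q j‖ ^ 2 + (K G m q i + K G m q j) / ‖q i - q j‖))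
    (fun i _ => Finset.sum_nonneg fun j _ => pairTerm_nonneg hG hm q v i j) (Finset.mem_univ i))
  exact Finset.single_le_sum (f := fun j =>
    (‖v i - v j‖ ^ 2 / ‖q i - q j‖ ^ 2 + (K G m q i + K G m q j) / ‖q i - q j‖))
    (fun j _ => pairTerm_nonneg hG hm q v i j) (Finset.mem_Ioi.mpr h)

theorem sInvSq_pos (hN : 2 ≤ N) (hG : 0 < G) (hm : ∀ i, 0 < m i) {q : Config N}
    (hq : q ∉ collisionSet N) (v : Config N) : 0 < sInvSq G m q v := by
  have : Nontrivial (Fin N) := Fin.nontrivial_iff_two_le.mpr hN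
  obtain ⟨i, j, hij⟩ := exists_pair_ne (Fin N)
  refine lt_of_lt_of_le ?_ (pairTerm_le_sInvSq hG hm q v hij)
  have := K_pos hN hG hm hq i
  have := K_pos hN hG hm hq j
  have := norm_sub_pos hq hij
  positivity

theorem s_pos (hN : 2 ≤ N) (hG : 0 < G) (hm : ∀ i, 0 < m i) {q : Config N}
    (hq : q ∉ collisionSet N) (v : Config N) : 0 < s G m q v :=
  Real.rpow_pos_of_pos (sInvSq_pos hN hG hm hq v) _

theorem s_sq_mul_sInvSq (hN : 2 ≤ N) (hG : 0 < G) (hm : ∀ i, 0 < m i) {q : Config N}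
    (hq : q ∉ collisionSet N) (v : Config N) : s G m q v ^ 2 * sInvSq G m q v = 1 := by
  have h := sInvSq_pos hN hG hm hq v
  rw [s, ← Real.rpow_natCast, ← Real.rpow_mul h.le]
  norm_num [Real.rpow_neg_one]
  exact inv_mul_cancel₀ h.ne'

/-! ### Analyticity of the real field -/

theorem contDiffAt_fst_apply (i : Fin N) (p : Config N × Config N) :
    ContDiffAt ℝ ω (fun p : Config N × Config N => p.1 i) p :=
  ((ContinuousLinearMap.proj (R := ℝ) (φ := fun _ : Fin N => EuclideanSpace ℝ (Fin 3)) i).comp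
    (ContinuousLinearMap.fst ℝ (Config N) (Config N))).contDiff.contDiffAt

theorem contDiffAt_snd_apply (i : Fin N) (p : Config N × Config N) :
    ContDiffAt ℝ ω (fun p : Config N × Config N => p.2 i) p :=
  ((ContinuousLinearMap.proj (R := ℝ) (φ := fun _ : Fin N => EuclideanSpace ℝ (Fin 3)) i).comp
    (ContinuousLinearMap.snd ℝ (Config N) (Config N))).contDiff.contDiffAt

theorem contDiffAt_norm_pair {p : Config N × Config N} (hp : p.1 ∉ collisionSet N) {i j : Fin N}
    (hij : i ≠ j) : ContDiffAt ℝ ω (fun p : Config N × Config N => ‖p.1 i - p.1 j‖) p :=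
  ((contDiffAt_fst_apply i p).sub (contDiffAt_fst_apply j p)).norm ℝ
    (norm_pos_iff.mp (norm_sub_pos hp hij))

theorem contDiffAt_K {p : Config N × Config N} (hp : p.1 ∉ collisionSet N) (i : Fin N) :
    ContDiffAt ℝ ω (fun p : Config N × Config N => K G m p.1 i) p := by
  refine ContDiffAt.sum fun k hk => ?_
  have hik := (Finset.ne_of_mem_erase hk).symm
  exact contDiffAt_const.div ((contDiffAt_norm_pair hp hik).pow 2)
    (pow_pos (norm_sub_pos hp hik) 2).ne'

theorem contDiffAt_s (hN : 2 ≤ N) (hG : 0 < G) (hm : ∀ i, 0 < m i) {p : Config N × Config N}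
    (hp : p.1 ∉ collisionSet N) :
    ContDiffAt ℝ ω (fun p : Config N × Config N => s G m p.1 p.2) p := by
  have h : ContDiffAt ℝ ω (fun p : Config N × Config N => sInvSq G m p.1 p.2) p := by
    refine (ContDiffAt.sum fun i _ => ContDiffAt.sum fun j hj => ?_).add
      (ContDiffAt.sum fun i _ => ContDiffAt.sum fun j hj => ?_)
    · have hij := (Finset.mem_Ioi.mp hj).ne
      exact (((contDiffAt_snd_apply i p).sub (contDiffAt_snd_apply j p)).norm_sq ℝ).div
        ((contDiffAt_norm_pair hp hij).pow 2) (pow_pos (norm_sub_pos hp hij) 2).ne'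
    · have hij := (Finset.mem_Ioi.mp hj).ne
      exact ((contDiffAt_K hp i).add (contDiffAt_K hp j)).div
        (contDiffAt_norm_pair hp hij) (norm_sub_pos hp hij).ne'
  exact h.rpow_const_of_ne (sInvSq_pos hN hG hm hp p.2).ne'

theorem contDiffAt_accel {p : Config N × Config N} (hp : p.1 ∉ collisionSet N) :
    ContDiffAt ℝ ω (fun p : Config N × Config N => accel G m p.1) p := by
  refine contDiffAt_pi.mpr fun i => ContDiffAt.sum fun j hj => ?_
  have hij := (Finset.ne_of_mem_erase hj).symm
  exact (contDiffAt_const.div ((contDiffAt_norm_pair hp hij).pow 3)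
    (pow_pos (norm_sub_pos hp hij) 3).ne').smul
    ((contDiffAt_fst_apply j p).sub (contDiffAt_fst_apply i p))

theorem contDiffAt_renormField (hN : 2 ≤ N) (hG : 0 < G) (hm : ∀ i, 0 < m i)
    {p : Config N × Config N} (hp : p.1 ∉ collisionSet N) :
    ContDiffAt ℝ ω (renormField G m) p :=
  ((contDiffAt_s hN hG hm hp).smul contDiffAt_snd).prodMk
    ((contDiffAt_s hN hG hm hp).smul (contDiffAt_accel hp))

/-! ### Analyticity of the complexified field -/

theorem analyticAt_fst_apply (i : Fin N) (p : CConfig N × CConfig N) :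
    AnalyticAt ℂ (fun p : CConfig N × CConfig N => p.1 i) p :=
  ((ContinuousLinearMap.proj (R := ℂ) (φ := fun _ : Fin N => EuclideanSpace ℂ (Fin 3)) i).comp
    (ContinuousLinearMap.fst ℂ (CConfig N) (CConfig N))).analyticAt p

theorem analyticAt_snd_apply (i : Fin N) (p : CConfig N × CConfig N) :
    AnalyticAt ℂ (fun p : CConfig N × CConfig N => p.2 i) p :=
  ((ContinuousLinearMap.proj (R := ℂ) (φ := fun _ : Fin N => EuclideanSpace ℂ (Fin 3)) i).comp
    (ContinuousLinearMap.snd ℂ (CConfig N) (CConfig N))).analyticAt p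

theorem analyticAt_pairSq {f : CConfig N × CConfig N → CConfig N} {p : CConfig N × CConfig N}
    (hf : ∀ i, AnalyticAt ℂ (fun p => f p i) p) (i j : Fin N) :
    AnalyticAt ℂ (fun p => pairSq (f p) i j) p := by
  have h : ∀ i k, AnalyticAt ℂ (fun p => f p i k) p := fun i k =>
    ((EuclideanSpace.proj (𝕜 := ℂ) k).analyticAt _).comp (hf i)
  refine Finset.analyticAt_fun_sum _ fun k _ => ?_
  exact ((h i k).sub (h j k)).pow 2

theorem analyticAt_pairSq_fst (i j : Fin N) (p : CConfig N × CConfig N) :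
    AnalyticAt ℂ (fun p : CConfig N × CConfig N => pairSq p.1 i j) p :=
  analyticAt_pairSq (fun i => analyticAt_fst_apply i p) i j

theorem analyticAt_KC {p : CConfig N × CConfig N}
    (hp : ∀ i j, i ≠ j → pairSq p.1 i j ∈ Complex.slitPlane) (i : Fin N) :
    AnalyticAt ℂ (fun p : CConfig N × CConfig N => KC G m p.1 i) p := by
  refine Finset.analyticAt_fun_sum _ fun k hk => ?_
  exact analyticAt_const.div (analyticAt_pairSq_fst i k p)
    (Complex.slitPlane_ne_zero (hp i k (Finset.ne_of_mem_erase hk).symm))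

theorem analyticAt_sInvSqC {p : CConfig N × CConfig N}
    (hp : ∀ i j, i ≠ j → pairSq p.1 i j ∈ Complex.slitPlane) :
    AnalyticAt ℂ (fun p : CConfig N × CConfig N => sInvSqC G m p.1 p.2) p := by
  refine (Finset.analyticAt_fun_sum _ fun i _ => Finset.analyticAt_fun_sum _ fun j hj => ?_).add
    (Finset.analyticAt_fun_sum _ fun i _ => Finset.analyticAt_fun_sum _ fun j hj => ?_)
  · have hij := hp i j (Finset.mem_Ioi.mp hj).ne
    exact (analyticAt_pairSq (fun i => analyticAt_snd_apply i p) i j).div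
      (analyticAt_pairSq_fst i j p) (Complex.slitPlane_ne_zero hij)
  · have hij := hp i j (Finset.mem_Ioi.mp hj).ne
    refine ((analyticAt_KC hp i).add (analyticAt_KC hp j)).div
      ((analyticAt_pairSq_fst i j p).cpow analyticAt_const hij) ?_
    simp [Complex.cpow_eq_zero_iff, Complex.slitPlane_ne_zero hij]

theorem analyticAt_renormFieldC {p : CConfig N × CConfig N} (hp : p ∈ complexDomain G m) :
    AnalyticAt ℂ (renormFieldC G m) p := by
  have hs : AnalyticAt ℂ (fun p : CConfig N × CConfig N => sC G m p.1 p.2) p :=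
    (analyticAt_sInvSqC hp.1).cpow analyticAt_const hp.2
  have ha : AnalyticAt ℂ (fun p : CConfig N × CConfig N => accelC G m p.1) p := by
    refine AnalyticAt.pi fun i => Finset.analyticAt_fun_sum _ fun j hj => ?_
    have hij := hp.1 i j (Finset.ne_of_mem_erase hj).symm
    refine (analyticAt_const.div ((analyticAt_pairSq_fst i j p).cpow analyticAt_const hij) ?_).smul
      ((analyticAt_fst_apply j p).sub (analyticAt_fst_apply i p))
    simp [Complex.cpow_eq_zero_iff, Complex.slitPlane_ne_zero hij]
  exact (hs.smul analyticAt_snd).prod (hs.smul ha)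

/-- Real smoothness suffices to use real ODE uniqueness along the real time axis. -/
theorem contDiffAt_renormFieldC {p : CConfig N × CConfig N} (hp : p ∈ complexDomain G m) :
    ContDiffAt ℝ 1 (renormFieldC G m) p :=
  ((analyticAt_renormFieldC hp).contDiffAt (n := 1)).restrict_scalars ℝ

/-! ### The real subspace -/

/-- Coordinatewise real part. -/
def reConfig : CConfig N →L[ℝ] Config N :=
  ContinuousLinearMap.pi fun i => (PiLp.continuousLinearEquiv 2 ℝ fun _ : Fin 3 => ℝ).symm ∘L
    ContinuousLinearMap.pi fun k => Complex.reCLM ∘L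
      ((EuclideanSpace.proj (𝕜 := ℂ) k).restrictScalars ℝ) ∘L ContinuousLinearMap.proj i

/-- Coordinatewise imaginary part. -/
def imConfig : CConfig N →L[ℝ] Config N :=
  ContinuousLinearMap.pi fun i => (PiLp.continuousLinearEquiv 2 ℝ fun _ : Fin 3 => ℝ).symm ∘L
    ContinuousLinearMap.pi fun k => Complex.imCLM ∘L
      ((EuclideanSpace.proj (𝕜 := ℂ) k).restrictScalars ℝ) ∘L ContinuousLinearMap.proj i

/-- The inclusion of the real configurations, as a continuous linear map. -/
def toComplexL : Config N →L[ℝ] CConfig N :=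
  ContinuousLinearMap.pi fun i => (PiLp.continuousLinearEquiv 2 ℝ fun _ : Fin 3 => ℂ).symm ∘L
    ContinuousLinearMap.pi fun k => Complex.ofRealCLM ∘L
      (EuclideanSpace.proj (𝕜 := ℝ) k) ∘L ContinuousLinearMap.proj i

theorem reConfig_apply (Q : CConfig N) (i : Fin N) (k : Fin 3) :
    reConfig Q i k = (Q i k).re := rfl

theorem imConfig_apply (Q : CConfig N) (i : Fin N) (k : Fin 3) :
    imConfig Q i k = (Q i k).im := rfl

theorem toComplex_apply (q : Config N) (i : Fin N) (k : Fin 3) :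
    toComplex q i k = (q i k : ℂ) := rfl

theorem reConfig_toComplex (q : Config N) : reConfig (toComplex q) = q := by
  ext i k; simp [reConfig_apply, toComplex_apply]

theorem imConfig_toComplex (q : Config N) : imConfig (toComplex q) = 0 := by
  ext i k; simp [imConfig_apply, toComplex_apply]

theorem toComplex_reConfig {Q : CConfig N} (h : imConfig Q = 0) : toComplex (reConfig Q) = Q := by
  ext i k
  have := congrArg (fun q : Config N => q i k) h
  apply Complex.ext
  · simp [reConfig_apply, toComplex_apply]
  · simpa [imConfig_apply, toComplex_apply] using this.symm

theorem pairSq_toComplex (q : Config N) (i j : Fin N) :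
    pairSq (toComplex q) i j = ((‖q i - q j‖ ^ 2 : ℝ) : ℂ) := by
  rw [EuclideanSpace.norm_sq_eq]
  simp [pairSq, toComplex_apply, Real.norm_eq_abs, sq_abs]

theorem pairSq_toComplex_cpow_half (q : Config N) (i j : Fin N) :
    pairSq (toComplex q) i j ^ (1 / 2 : ℂ) = (‖q i - q j‖ : ℂ) := by
  rw [pairSq_toComplex, show (1 / 2 : ℂ) = ((1 / 2 : ℝ) : ℂ) by norm_num,
    ← Complex.ofReal_cpow (by positivity), ← Real.sqrt_eq_rpow, Real.sqrt_sq (norm_nonneg _)]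

theorem pairSq_toComplex_cpow_three_half (q : Config N) (i j : Fin N) :
    pairSq (toComplex q) i j ^ (3 / 2 : ℂ) = ((‖q i - q j‖ ^ 3 : ℝ) : ℂ) := by
  rw [pairSq_toComplex, show (3 / 2 : ℂ) = ((3 / 2 : ℝ) : ℂ) by norm_num,
    ← Complex.ofReal_cpow (by positivity), ← Real.rpow_natCast, ← Real.rpow_mul (norm_nonneg _),
    ← Real.rpow_natCast]
  norm_num

theorem KC_toComplex (q : Config N) (i : Fin N) :
    KC G m (toComplex q) i = (K G m q i : ℂ) := by
  simp [KC, K, pairSq_toComplex]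

theorem sInvSqC_toComplex (q v : Config N) :
    sInvSqC G m (toComplex q) (toComplex v) = (sInvSq G m q v : ℂ) := by
  simp only [sInvSqC, sInvSq, pairSq_toComplex_cpow_half, KC_toComplex]
  simp only [pairSq_toComplex]
  push_cast
  rfl

theorem accelC_toComplex (q : Config N) :
    accelC G m (toComplex q) = toComplex (accel G m q) := by
  ext i k
  simp [accelC, accel, pairSq_toComplex_cpow_three_half, toComplex_apply]

theorem sC_toComplex (hN : 2 ≤ N) (hG : 0 < G) (hm : ∀ i, 0 < m i) {q : Config N}
    (hq : q ∉ collisionSet N) (v : Config N) :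
    sC G m (toComplex q) (toComplex v) = (s G m q v : ℂ) := by
  rw [sC, s, sInvSqC_toComplex, show (-(1 / 2) : ℂ) = ((-(1 / 2) : ℝ) : ℂ) by norm_num,
    ← Complex.ofReal_cpow (sInvSq_pos hN hG hm hq v).le]

theorem ofReal_smul_toComplex (c : ℝ) (q : Config N) :
    (c : ℂ) • toComplex q = toComplex (c • q) := by
  ext i k; simp [toComplex_apply]

theorem renormFieldC_toComplex (hN : 2 ≤ N) (hG : 0 < G) (hm : ∀ i, 0 < m i) {q : Config N}
    (hq : q ∉ collisionSet N) (v : Config N) :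
    renormFieldC G m (toComplex q, toComplex v) =
      (toComplex (renormField G m (q, v)).1, toComplex (renormField G m (q, v)).2) := by
  simp only [renormFieldC, renormField, sC_toComplex hN hG hm hq, accelC_toComplex,
    ofReal_smul_toComplex]

end NBody

namespace NBody

variable {N : ℕ} {G : ℝ} {m : Fin N → ℝ}

/-! ### Perturbation of `uᵀu` and of its powers -/

/-- Expand `(u + w)ᵀ(u + w)` and use Cauchy–Schwarz on the cross term. -/
theorem norm_sum_sq_sub_le {n : ℕ} (u : EuclideanSpace ℝ (Fin n)) (U w : EuclideanSpace ℂ (Fin n))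
    (h : ∀ k, U k = u k + w k) {d : ℝ} (hw : ‖w‖ ≤ d) :
    ‖∑ k, U k ^ 2 - ((‖u‖ ^ 2 : ℝ) : ℂ)‖ ≤ 2 * ‖u‖ * d + d ^ 2 := by
  have e : ∑ k, U k ^ 2 - ((‖u‖ ^ 2 : ℝ) : ℂ) = ∑ k, (2 * (u k * w k) + w k ^ 2) := by
    rw [EuclideanSpace.norm_sq_eq, Complex.ofReal_sum, ← Finset.sum_sub_distrib]
    refine Finset.sum_congr rfl fun k _ => ?_
    rw [h, Real.norm_eq_abs, sq_abs]
    push_cast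
    ring
  have h1 : ∑ k, ‖u k‖ * ‖w k‖ ≤ ‖u‖ * ‖w‖ := by
    rw [EuclideanSpace.norm_eq u, EuclideanSpace.norm_eq w]
    exact Real.sum_mul_le_sqrt_mul_sqrt _ _ _
  have h2 : ∑ k, ‖w k‖ ^ 2 = ‖w‖ ^ 2 := (EuclideanSpace.norm_sq_eq w).symm
  rw [e]
  calc ‖∑ k, (2 * (u k * w k) + w k ^ 2)‖ ≤ ∑ k, (2 * (‖u k‖ * ‖w k‖) + ‖w k‖ ^ 2) := by
        refine (norm_sum_le _ _).trans (Finset.sum_le_sum fun k _ => ?_)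
        refine (norm_add_le _ _).trans_eq ?_
        simp [norm_pow]
    _ = 2 * ∑ k, ‖u k‖ * ‖w k‖ + ‖w‖ ^ 2 := by
        rw [Finset.sum_add_distrib, h2, Finset.mul_sum]
    _ ≤ 2 * (‖u‖ * ‖w‖) + ‖w‖ ^ 2 := by linarith
    _ ≤ 2 * ‖u‖ * d + d ^ 2 := by
        nlinarith [norm_nonneg u, norm_nonneg w,
          mul_le_mul_of_nonneg_left hw (norm_nonneg u)]

section Powers

variable {P : ℂ} {r : ℝ}

/-- Here `33/256 = 2 * (1/16) + (1/16)^2` is the relative error of `uᵀu` when `u` moves by 1/16 of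
its length, and `223/256` is its complement to 1. -/
theorem re_ge_of_near (h : ‖P - ((r ^ 2 : ℝ) : ℂ)‖ ≤ 33 / 256 * r ^ 2) :
    223 / 256 * r ^ 2 ≤ P.re := by
  have := (Complex.abs_re_le_norm _).trans h
  rw [Complex.sub_re, Complex.ofReal_re] at this
  linarith [(abs_le.mp this).1]

theorem mem_slitPlane_of_near (hr : 0 < r) (h : ‖P - ((r ^ 2 : ℝ) : ℂ)‖ ≤ 33 / 256 * r ^ 2) :
    P ∈ Complex.slitPlane :=
  Or.inl (lt_of_lt_of_le (by positivity) (re_ge_of_near h))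

theorem norm_ge_of_near (h : ‖P - ((r ^ 2 : ℝ) : ℂ)‖ ≤ 33 / 256 * r ^ 2) :
    223 / 256 * r ^ 2 ≤ ‖P‖ :=
  (re_ge_of_near h).trans (Complex.re_le_norm P)

theorem cpow_half_mul_self (P : ℂ) : P ^ (1 / 2 : ℂ) * P ^ (1 / 2 : ℂ) = P := by
  have := Complex.cpow_nat_inv_pow P (n := 2) two_ne_zero
  rw [pow_two] at this
  simpa using this

theorem cpow_half_re_pos (hP : P ∈ Complex.slitPlane) : 0 < (P ^ (1 / 2 : ℂ)).re := by
  rw [Complex.cpow_def_of_ne_zero (Complex.slitPlane_ne_zero hP), Complex.exp_re]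
  refine mul_pos (Real.exp_pos _) (Real.cos_pos_of_mem_Ioo ?_)
  have e : (Complex.log P * (1 / 2)).im = P.arg / 2 := by
    rw [show (1 / 2 : ℂ) = ((1 / 2 : ℝ) : ℂ) by norm_num, mul_comm, Complex.im_ofReal_mul,
      Complex.log_im]
    ring
  have h1 := Complex.neg_pi_lt_arg P
  have h2 := lt_of_le_of_ne (Complex.arg_le_pi P) (Complex.mem_slitPlane_iff_arg.mp hP).1
  rw [e]
  constructor <;> linarith

/-- The square root `w` has `(Re w)² ≥ Re (w²) = Re P`, and `(23/25)² ≤ 223/256`. -/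
theorem cpow_half_re_ge (hr : 0 < r) (h : ‖P - ((r ^ 2 : ℝ) : ℂ)‖ ≤ 33 / 256 * r ^ 2) :
    23 / 25 * r ≤ (P ^ (1 / 2 : ℂ)).re := by
  have h1 := cpow_half_re_pos (mem_slitPlane_of_near hr h)
  have h2 := congrArg Complex.re (cpow_half_mul_self P)
  rw [Complex.mul_re] at h2
  have h3 := re_ge_of_near h
  refine le_of_sq_le_sq ?_ h1.le
  nlinarith [sq_nonneg (P ^ (1 / 2 : ℂ)).im]

theorem norm_cpow_three_half_ge (hr : 0 < r) (h : ‖P - ((r ^ 2 : ℝ) : ℂ)‖ ≤ 33 / 256 * r ^ 2) :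
    223 / 256 * (23 / 25) * r ^ 3 ≤ ‖P ^ (3 / 2 : ℂ)‖ := by
  have e : P ^ (3 / 2 : ℂ) = P * P ^ (1 / 2 : ℂ) := by
    rw [show (3 / 2 : ℂ) = 1 + 1 / 2 by norm_num,
      Complex.cpow_add _ _ (Complex.slitPlane_ne_zero (mem_slitPlane_of_near hr h)),
      Complex.cpow_one]
  rw [e, norm_mul]
  calc 223 / 256 * (23 / 25) * r ^ 3 = (223 / 256 * r ^ 2) * (23 / 25 * r) := by ring
    _ ≤ ‖P‖ * ‖P ^ (1 / 2 : ℂ)‖ := by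
        gcongr
        · exact norm_ge_of_near h
        · exact (cpow_half_re_ge hr h).trans (Complex.re_le_norm _)

theorem norm_inv_sub_le (hr : 0 < r) (h : ‖P - ((r ^ 2 : ℝ) : ℂ)‖ ≤ 33 / 256 * r ^ 2) :
    ‖P⁻¹ - (((r ^ 2)⁻¹ : ℝ) : ℂ)‖ ≤ 33 / 223 * (r ^ 2)⁻¹ := by
  have hP := Complex.slitPlane_ne_zero (mem_slitPlane_of_near hr h)
  have hP' := norm_ge_of_near h
  have hr2 : 0 < r ^ 2 := by positivity
  have e : P⁻¹ - (((r ^ 2)⁻¹ : ℝ) : ℂ) = -(P - ((r ^ 2 : ℝ) : ℂ)) / (P * ((r ^ 2 : ℝ) : ℂ)) := by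
    have : ((r ^ 2 : ℝ) : ℂ) ≠ 0 := by exact_mod_cast hr2.ne'
    rw [Complex.ofReal_inv]
    field_simp
    ring
  rw [e, norm_div, norm_neg, norm_mul, Complex.norm_real, Real.norm_of_nonneg hr2.le]
  calc ‖P - ((r ^ 2 : ℝ) : ℂ)‖ / (‖P‖ * r ^ 2)
      ≤ 33 / 256 * r ^ 2 / (223 / 256 * r ^ 2 * r ^ 2) := by gcongr
    _ = 33 / 223 * (r ^ 2)⁻¹ := by field_simp

theorem norm_cpow_half_inv_sub_le (hr : 0 < r)
    (h : ‖P - ((r ^ 2 : ℝ) : ℂ)‖ ≤ 33 / 256 * r ^ 2) :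
    ‖(P ^ (1 / 2 : ℂ))⁻¹ - ((r⁻¹ : ℝ) : ℂ)‖ ≤ 73 / 1000 * r⁻¹ := by
  have hw := cpow_half_re_ge hr h
  have hww := cpow_half_mul_self P
  set w := P ^ (1 / 2 : ℂ)
  have hwn : 23 / 25 * r ≤ ‖w‖ := hw.trans (Complex.re_le_norm w)
  have hw0 : w ≠ 0 := norm_pos_iff.mp (lt_of_lt_of_le (by positivity) hwn)
  have hsn : 48 / 25 * r ≤ ‖w + r‖ := by
    refine le_trans ?_ (Complex.re_le_norm _)
    rw [Complex.add_re, Complex.ofReal_re]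
    linarith
  have hs0 : w + r ≠ 0 := norm_pos_iff.mp (lt_of_lt_of_le (by positivity) hsn)
  have hr0 : (r : ℂ) ≠ 0 := by exact_mod_cast hr.ne'
  -- With `w² = P`, the difference `r - w` is `(r² - P) / (w + r)`.
  have e : w⁻¹ - ((r⁻¹ : ℝ) : ℂ) = -(P - ((r ^ 2 : ℝ) : ℂ)) / ((w + r) * w * r) := by
    rw [Complex.ofReal_inv, ← hww]
    push_cast
    field_simp
    ring
  rw [e, norm_div, norm_neg, norm_mul, norm_mul, Complex.norm_real, Real.norm_of_nonneg hr.le]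
  calc ‖P - ((r ^ 2 : ℝ) : ℂ)‖ / (‖w + r‖ * ‖w‖ * r)
      ≤ 33 / 256 * r ^ 2 / (48 / 25 * r * (23 / 25 * r) * r) := by gcongr
    _ = 33 / 256 / (48 / 25 * (23 / 25)) * r⁻¹ := by field_simp
    _ ≤ 73 / 1000 * r⁻¹ := mul_le_mul_of_nonneg_right (by norm_num) (by positivity)

end Powers

theorem norm_mul_sub_mul_le {a' b' : ℂ} {a b ε δ : ℝ} (ha : 0 ≤ a) (hb : 0 ≤ b)
    (h1 : ‖a' - a‖ ≤ ε * a) (h2 : ‖b' - b‖ ≤ δ * b) :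
    ‖a' * b' - ((a * b : ℝ) : ℂ)‖ ≤ (ε + δ + ε * δ) * (a * b) := by
  have e : a' * b' - ((a * b : ℝ) : ℂ) = (a' - a) * (b' - b) + (a' - a) * b + a * (b' - b) := by
    push_cast; ring
  rw [e]
  calc ‖(a' - a) * (b' - b) + (a' - a) * b + a * (b' - b)‖
      ≤ ‖a' - a‖ * ‖b' - b‖ + ‖a' - a‖ * b + a * ‖b' - b‖ := by
        refine (norm_add₃_le).trans_eq ?_
        simp only [norm_mul, Complex.norm_real, Real.norm_of_nonneg ha, Real.norm_of_nonneg hb]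
    _ ≤ (ε * a) * (δ * b) + (ε * a) * b + a * (δ * b) := by
        gcongr
        exact (norm_nonneg _).trans h1
    _ = (ε + δ + ε * δ) * (a * b) := by ring

/-! ### The complex neighbourhood of a real state -/

theorem norm_toComplex_sub (q : Config N) (i j : Fin N) :
    ‖toComplex q i - toComplex q j‖ = ‖q i - q j‖ := by
  rw [EuclideanSpace.norm_eq, EuclideanSpace.norm_eq]
  congr 1
  refine Finset.sum_congr rfl fun k _ => ?_
  rw [PiLp.sub_apply, PiLp.sub_apply, toComplex_apply, toComplex_apply, ← Complex.ofReal_sub,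
    Complex.norm_real]

theorem norm_toComplex (q : Config N) (i : Fin N) : ‖toComplex q i‖ = ‖q i‖ := by
  rw [EuclideanSpace.norm_eq, EuclideanSpace.norm_eq]
  congr 1
  exact Finset.sum_congr rfl fun k _ => by rw [toComplex_apply, Complex.norm_real]

/-- The complex states whose relative positions and velocities are close to those of the real
state `(q, v)`. -/
def nearStates (G : ℝ) (m : Fin N → ℝ) (q v : Config N) : Set (CConfig N × CConfig N) :=
  {p | (∀ i j, ‖(p.1 i - p.1 j) - (toComplex q i - toComplex q j)‖ ≤ 1 / 16 * ‖q i - q j‖) ∧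
    ∀ i, ‖p.2 i - toComplex v i‖ ≤ 2 / 25 * s G m q v * K G m q i}

/-! ### Bounds for the complexified field near a real state -/

section Estimates

variable {q v : Config N} {p : CConfig N × CConfig N}

theorem norm_pairSq_sub_le (hp : p ∈ nearStates G m q v) (i j : Fin N) :
    ‖pairSq p.1 i j - ((‖q i - q j‖ ^ 2 : ℝ) : ℂ)‖ ≤ 33 / 256 * ‖q i - q j‖ ^ 2 := by
  have := norm_sum_sq_sub_le (q i - q j) (p.1 i - p.1 j)
    ((p.1 i - p.1 j) - (toComplex q i - toComplex q j))
    (fun k => by simp [toComplex_apply]) (hp.1 i j)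
  refine this.trans_eq ?_
  ring

theorem norm_velocity_sub_le (hp : p ∈ nearStates G m q v) (i j : Fin N) :
    ‖(p.2 i - p.2 j) - (toComplex v i - toComplex v j)‖
      ≤ 2 / 25 * s G m q v * (K G m q i + K G m q j) := by
  rw [show (p.2 i - p.2 j) - (toComplex v i - toComplex v j) =
    (p.2 i - toComplex v i) - (p.2 j - toComplex v j) by abel]
  refine (norm_sub_le _ _).trans ?_
  rw [mul_add]
  exact add_le_add (hp.2 i) (hp.2 j)

theorem norm_KC_sub_le (hG : 0 < G) (hm : ∀ i, 0 < m i) (hq : q ∉ collisionSet N)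
    (hp : p ∈ nearStates G m q v) (i : Fin N) :
    ‖KC G m p.1 i - K G m q i‖ ≤ 33 / 223 * K G m q i := by
  rw [KC, K, Complex.ofReal_sum, ← Finset.sum_sub_distrib, Finset.mul_sum]
  refine norm_sum_le_of_le _ fun k hk => ?_
  have h := norm_inv_sub_le (norm_sub_pos hq (Finset.ne_of_mem_erase hk).symm)
    (norm_pairSq_sub_le hp i k)
  have hGm : 0 ≤ G * m k := (mul_pos hG (hm k)).le
  have e : (G * m k : ℂ) / pairSq p.1 i k - ((G * m k / ‖q i - q k‖ ^ 2 : ℝ) : ℂ) =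
      ((G * m k : ℝ) : ℂ) * ((pairSq p.1 i k)⁻¹ - (((‖q i - q k‖ ^ 2)⁻¹ : ℝ) : ℂ)) := by
    push_cast
    ring
  rw [e, norm_mul, Complex.norm_real, Real.norm_of_nonneg hGm]
  refine (mul_le_mul_of_nonneg_left h hGm).trans_eq ?_
  ring

theorem norm_accelC_le (hG : 0 < G) (hm : ∀ i, 0 < m i) (hq : q ∉ collisionSet N)
    (hp : p ∈ nearStates G m q v) (i : Fin N) :
    ‖accelC G m p.1 i‖ ≤ 4 / 3 * K G m q i := by
  rw [accelC, K, Finset.mul_sum]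
  refine norm_sum_le_of_le _ fun j hj => ?_
  have hij := (Finset.ne_of_mem_erase hj).symm
  have hr := norm_sub_pos hq hij
  have h := norm_cpow_three_half_ge hr (norm_pairSq_sub_le hp i j)
  have hGm : 0 < G * m j := mul_pos hG (hm j)
  have hn : ‖p.1 j - p.1 i‖ ≤ 17 / 16 * ‖q i - q j‖ := by
    rw [norm_sub_rev]
    have h1 := norm_add_le ((p.1 i - p.1 j) - (toComplex q i - toComplex q j))
      (toComplex q i - toComplex q j)
    rw [sub_add_cancel, norm_toComplex_sub] at h1
    linarith [hp.1 i j]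
  rw [norm_smul, norm_div, ← Complex.ofReal_mul, Complex.norm_real, Real.norm_of_nonneg hGm.le]
  calc G * m j / ‖pairSq p.1 i j ^ (3 / 2 : ℂ)‖ * ‖p.1 j - p.1 i‖
      ≤ G * m j / (223 / 256 * (23 / 25) * ‖q i - q j‖ ^ 3) * (17 / 16 * ‖q i - q j‖) := by gcongr
    _ = 17 / 16 / (223 / 256 * (23 / 25)) * (G * m j / ‖q i - q j‖ ^ 2) := by field_simp
    _ ≤ 4 / 3 * (G * m j / ‖q i - q j‖ ^ 2) := mul_le_mul_of_nonneg_right (by norm_num) (by positivity)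

/-- Normalized bounds on a pair of bodies, from the definition of `s`. -/
theorem s_mul_pair_le (hN : 2 ≤ N) (hG : 0 < G) (hm : ∀ i, 0 < m i) (hq : q ∉ collisionSet N)
    (v : Config N) {i j : Fin N} (hij : i ≠ j) :
    (s G m q v * (‖v i - v j‖ / ‖q i - q j‖)) ^ 2 +
      s G m q v ^ 2 * ((K G m q i + K G m q j) / ‖q i - q j‖) ≤ 1 := by
  rw [← s_sq_mul_sInvSq hN hG hm hq v, mul_pow, ← mul_add, div_pow]
  exact mul_le_mul_of_nonneg_left (pairTerm_le_sInvSq hG hm q v hij) (sq_nonneg _)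

/-- The velocities are displaced by multiples of `s * K`, not of `‖v i - v j‖`, so this error cannot
be relative to the kinetic term alone. Since `s * ‖v i - v j‖ ≤ ‖q i - q j‖`, the cross term is
charged to the potential term of the same pair. -/
theorem norm_kinetic_sub_le (hN : 2 ≤ N) (hG : 0 < G) (hm : ∀ i, 0 < m i)
    (hq : q ∉ collisionSet N) (hp : p ∈ nearStates G m q v) {i j : Fin N} (hij : i ≠ j) :
    ‖pairSq p.2 i j / pairSq p.1 i j - ((‖v i - v j‖ ^ 2 / ‖q i - q j‖ ^ 2 : ℝ) : ℂ)‖ ≤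
      33 / 223 * (‖v i - v j‖ ^ 2 / ‖q i - q j‖ ^ 2) +
        1 / 5 * ((K G m q i + K G m q j) / ‖q i - q j‖) := by
  have hr := norm_sub_pos hq hij
  have hnear := norm_pairSq_sub_le hp i j
  have hinv := norm_inv_sub_le hr hnear
  have hP := norm_ge_of_near hnear
  have hpair := s_mul_pair_le hN hG hm hq v hij
  have hs := s_pos hN hG hm hq v
  have hK := add_pos (K_pos hN hG hm hq i) (K_pos hN hG hm hq j)
  have hW := norm_sum_sq_sub_le (v i - v j) (p.2 i - p.2 j)
    ((p.2 i - p.2 j) - (toComplex v i - toComplex v j))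
    (fun k => by simp [toComplex_apply]) (norm_velocity_sub_le hp i j)
  change ‖pairSq p.2 i j - ((‖v i - v j‖ ^ 2 : ℝ) : ℂ)‖ ≤ _ at hW
  set r := ‖q i - q j‖
  set n := ‖v i - v j‖
  set k := K G m q i + K G m q j
  set σ := s G m q v
  have hn : 0 ≤ n := norm_nonneg _
  obtain ⟨x, hx⟩ : ∃ x, x = n / r := ⟨_, rfl⟩
  obtain ⟨a, ha⟩ : ∃ a, a = k / r := ⟨_, rfl⟩
  have hnx : n = x * r := by rw [hx]; field_simp
  have hka : k = a * r := by rw [ha]; field_simp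
  have hx0 : 0 ≤ x := by rw [hx]; positivity
  have ha0 : 0 ≤ a := by rw [ha]; positivity
  rw [← hx, ← ha] at hpair
  have hσx : σ * x ≤ 1 := by
    have : (σ * x) ^ 2 ≤ 1 := by nlinarith [mul_nonneg (sq_nonneg σ) ha0]
    exact (sq_le_one_iff₀ (by positivity)).mp this
  have hσa : σ ^ 2 * a ≤ 1 := by nlinarith [sq_nonneg (σ * x)]
  -- `104/625 = 4/25 + 4/625`: the linear and the quadratic part of the velocity error, with `σ * x`
  -- and `σ ^ 2 * a` bounded by 1.
  have hW' : ‖pairSq p.2 i j - ((n ^ 2 : ℝ) : ℂ)‖ ≤ 104 / 625 * a * r ^ 2 := by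
    refine hW.trans ?_
    rw [hnx, hka]
    have e : 2 * (x * r) * (2 / 25 * σ * (a * r)) + (2 / 25 * σ * (a * r)) ^ 2 =
      (4 / 25 * (σ * x) + 4 / 625 * (σ ^ 2 * a)) * (a * r ^ 2) := by ring
    rw [e, mul_assoc]
    gcongr
    linarith
  have e : pairSq p.2 i j / pairSq p.1 i j - ((n ^ 2 / r ^ 2 : ℝ) : ℂ) =
      (pairSq p.2 i j - ((n ^ 2 : ℝ) : ℂ)) / pairSq p.1 i j +
        ((n ^ 2 : ℝ) : ℂ) * ((pairSq p.1 i j)⁻¹ - (((r ^ 2)⁻¹ : ℝ) : ℂ)) := by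
    push_cast
    ring
  rw [e]
  refine (norm_add_le _ _).trans ?_
  rw [norm_div, norm_mul, Complex.norm_real, Real.norm_of_nonneg (sq_nonneg n), ← ha, add_comm]
  refine add_le_add ?_ ?_
  · refine (mul_le_mul_of_nonneg_left hinv (sq_nonneg n)).trans_eq ?_
    ring
  · calc ‖pairSq p.2 i j - ((n ^ 2 : ℝ) : ℂ)‖ / ‖pairSq p.1 i j‖
        ≤ 104 / 625 * a * r ^ 2 / (223 / 256 * r ^ 2) := by gcongr
      _ = 104 / 625 / (223 / 256) * a := by field_simp
      _ ≤ 1 / 5 * a := mul_le_mul_of_nonneg_right (by norm_num) (by positivity)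

theorem norm_potential_sub_le (hG : 0 < G) (hm : ∀ i, 0 < m i)
    (hq : q ∉ collisionSet N) (hp : p ∈ nearStates G m q v) {i j : Fin N} (hij : i ≠ j) :
    ‖(KC G m p.1 i + KC G m p.1 j) / pairSq p.1 i j ^ (1 / 2 : ℂ) -
      (((K G m q i + K G m q j) / ‖q i - q j‖ : ℝ) : ℂ)‖ ≤
        117 / 500 * ((K G m q i + K G m q j) / ‖q i - q j‖) := by
  have hr := norm_sub_pos hq hij
  have hK := add_nonneg (K_nonneg hG hm q i) (K_nonneg hG hm q j)
  have h1 : ‖(KC G m p.1 i + KC G m p.1 j) - ((K G m q i + K G m q j : ℝ) : ℂ)‖ ≤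
      33 / 223 * (K G m q i + K G m q j) := by
    push_cast
    rw [add_sub_add_comm, mul_add]
    exact norm_add_le_of_le (norm_KC_sub_le hG hm hq hp i) (norm_KC_sub_le hG hm hq hp j)
  have := norm_mul_sub_mul_le hK (inv_nonneg.mpr hr.le) h1
    (norm_cpow_half_inv_sub_le hr (norm_pairSq_sub_le hp i j))
  rw [div_eq_mul_inv, div_eq_mul_inv]
  exact this.trans (mul_le_mul_of_nonneg_right (by norm_num) (by positivity))

theorem norm_sInvSqC_sub_le (hN : 2 ≤ N) (hG : 0 < G) (hm : ∀ i, 0 < m i)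
    (hq : q ∉ collisionSet N) (hp : p ∈ nearStates G m q v) :
    ‖sInvSqC G m p.1 p.2 - sInvSq G m q v‖ ≤ 7 / 16 * sInvSq G m q v := by
  have e : sInvSqC G m p.1 p.2 - sInvSq G m q v = ∑ i, ∑ j ∈ Finset.Ioi i,
      ((pairSq p.2 i j / pairSq p.1 i j - ((‖v i - v j‖ ^ 2 / ‖q i - q j‖ ^ 2 : ℝ) : ℂ)) +
      ((KC G m p.1 i + KC G m p.1 j) / pairSq p.1 i j ^ (1 / 2 : ℂ) -
        (((K G m q i + K G m q j) / ‖q i - q j‖ : ℝ) : ℂ))) := by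
    simp only [sInvSqC, sInvSq, Complex.ofReal_add, Complex.ofReal_sum, Finset.sum_add_distrib,
      Finset.sum_sub_distrib]
    ring
  rw [e, sInvSq_eq, Finset.mul_sum]
  refine norm_sum_le_of_le _ fun i _ => ?_
  rw [Finset.mul_sum]
  refine norm_sum_le_of_le _ fun j hj => ?_
  have hij := (Finset.mem_Ioi.mp hj).ne
  have h1 := norm_kinetic_sub_le hN hG hm hq hp hij
  have h2 := norm_potential_sub_le hG hm hq hp hij
  have hx : 0 ≤ ‖v i - v j‖ ^ 2 / ‖q i - q j‖ ^ 2 := by positivity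
  have ha : 0 ≤ (K G m q i + K G m q j) / ‖q i - q j‖ :=
    div_nonneg (add_nonneg (K_nonneg hG hm q i) (K_nonneg hG hm q j)) (norm_nonneg _)
  refine (norm_add_le_of_le h1 h2).trans ?_
  -- The kinetic coefficient is 33/223 and the potential one `1/5 + 117/500`; both are at most 7/16.
  -- The choice 7/16 leaves `9/16 = (3/4)²`, whence the factor 4/3 for `s`.
  linarith

theorem nearStates_subset_complexDomain (hN : 2 ≤ N) (hG : 0 < G) (hm : ∀ i, 0 < m i)
    (hq : q ∉ collisionSet N) : nearStates G m q v ⊆ complexDomain G m := by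
  intro p hp
  refine ⟨fun i j hij => mem_slitPlane_of_near (norm_sub_pos hq hij) (norm_pairSq_sub_le hp i j),
    Or.inl ?_⟩
  have h := (Complex.abs_re_le_norm _).trans (norm_sInvSqC_sub_le hN hG hm hq hp)
  rw [Complex.sub_re, Complex.ofReal_re] at h
  have := sInvSq_pos hN hG hm hq v
  linarith [(abs_le.mp h).1]

theorem norm_sC_le (hN : 2 ≤ N) (hG : 0 < G) (hm : ∀ i, 0 < m i)
    (hq : q ∉ collisionSet N) (hp : p ∈ nearStates G m q v) :
    ‖sC G m p.1 p.2‖ ≤ 4 / 3 * s G m q v := by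
  have hS := sInvSq_pos hN hG hm hq v
  have h : 9 / 16 * sInvSq G m q v ≤ ‖sInvSqC G m p.1 p.2‖ := by
    have h1 := norm_sInvSqC_sub_le hN hG hm hq hp
    have h2 := norm_sub_norm_le (sInvSq G m q v : ℂ) (sInvSqC G m p.1 p.2)
    rw [norm_sub_rev, Complex.norm_real, Real.norm_of_nonneg hS.le] at h2
    linarith
  have e : (9 / 16 : ℝ) ^ (-(1 / 2) : ℝ) = 4 / 3 := by
    rw [Real.rpow_neg (by norm_num), ← Real.sqrt_eq_rpow,
      show (9 / 16 : ℝ) = (3 / 4) ^ 2 by norm_num, Real.sqrt_sq (by norm_num)]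
    norm_num
  rw [sC, show (-(1 / 2) : ℂ) = ((-(1 / 2) : ℝ) : ℂ) by norm_num, Complex.norm_cpow_real]
  calc ‖sInvSqC G m p.1 p.2‖ ^ (-(1 / 2) : ℝ) ≤ (9 / 16 * sInvSq G m q v) ^ (-(1 / 2) : ℝ) :=
        Real.rpow_le_rpow_of_nonpos (by positivity) h (by norm_num)
    _ = 4 / 3 * s G m q v := by rw [Real.mul_rpow (by norm_num) hS.le, e, s]

theorem norm_renormFieldC_snd_le (hN : 2 ≤ N) (hG : 0 < G) (hm : ∀ i, 0 < m i)
    (hq : q ∉ collisionSet N) (hp : p ∈ nearStates G m q v) (i : Fin N) :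
    ‖(renormFieldC G m p).2 i‖ ≤ 16 / 9 * s G m q v * K G m q i := by
  change ‖sC G m p.1 p.2 • accelC G m p.1 i‖ ≤ _
  rw [norm_smul]
  have hs := s_pos hN hG hm hq v
  calc ‖sC G m p.1 p.2‖ * ‖accelC G m p.1 i‖
      ≤ (4 / 3 * s G m q v) * (4 / 3 * K G m q i) := by
        gcongr
        · exact norm_sC_le hN hG hm hq hp
        · exact norm_accelC_le hG hm hq hp i
    _ = 16 / 9 * s G m q v * K G m q i := by ring

theorem norm_renormFieldC_fst_sub_le (hN : 2 ≤ N) (hG : 0 < G) (hm : ∀ i, 0 < m i)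
    (hq : q ∉ collisionSet N) (hp : p ∈ nearStates G m q v) (i j : Fin N) :
    ‖(renormFieldC G m p).1 i - (renormFieldC G m p).1 j‖ ≤ 4 / 3 * ‖q i - q j‖ := by
  rcases eq_or_ne i j with rfl | hij
  · simp
  change ‖sC G m p.1 p.2 • p.2 i - sC G m p.1 p.2 • p.2 j‖ ≤ _
  rw [← smul_sub, norm_smul]
  have hs := s_pos hN hG hm hq v
  have hr := norm_sub_pos hq hij
  have hK := add_pos (K_pos hN hG hm hq i) (K_pos hN hG hm hq j)
  have hpair := s_mul_pair_le hN hG hm hq v hij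
  have hv : ‖p.2 i - p.2 j‖ ≤
      ‖v i - v j‖ + 2 / 25 * s G m q v * (K G m q i + K G m q j) := by
    have h1 := norm_add_le ((p.2 i - p.2 j) - (toComplex v i - toComplex v j))
      (toComplex v i - toComplex v j)
    rw [sub_add_cancel, norm_toComplex_sub] at h1
    linarith [norm_velocity_sub_le hp i j]
  have hsC := norm_sC_le hN hG hm hq hp
  set r := ‖q i - q j‖
  set n := ‖v i - v j‖
  set k := K G m q i + K G m q j
  set σ := s G m q v
  have hn : 0 ≤ n := norm_nonneg _
  obtain ⟨x, hx⟩ : ∃ x, x = n / r := ⟨_, rfl⟩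
  obtain ⟨a, ha⟩ : ∃ a, a = k / r := ⟨_, rfl⟩
  have hnx : n = x * r := by rw [hx]; field_simp
  have hka : k = a * r := by rw [ha]; field_simp
  have hx0 : 0 ≤ x := by rw [hx]; positivity
  have ha0 : 0 ≤ a := by rw [ha]; positivity
  rw [← hx, ← ha] at hpair
  calc ‖sC G m p.1 p.2‖ * ‖p.2 i - p.2 j‖
      ≤ (4 / 3 * σ) * (n + 2 / 25 * σ * k) := by gcongr
    _ = 4 / 3 * (σ * x + 2 / 25 * (σ ^ 2 * a)) * r := by rw [hnx, hka]; ring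
    _ ≤ 4 / 3 * 1 * r := by
        gcongr
        -- From `(σ * x) ^ 2 + σ ^ 2 * a ≤ 1` and `σ * x ≤ (1 + (σ * x) ^ 2) / 2`: the velocity
        -- perturbation costs nothing beyond the bound 1.
        nlinarith [sq_nonneg (σ * x - 1), mul_nonneg (sq_nonneg σ) ha0]
    _ = 4 / 3 * r := by ring

theorem norm_renormFieldC_fst_le (hN : 2 ≤ N) (hG : 0 < G) (hm : ∀ i, 0 < m i)
    (hq : q ∉ collisionSet N) (hp : p ∈ nearStates G m q v) (i : Fin N) :
    ‖(renormFieldC G m p).1 i‖ ≤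
      4 / 3 * s G m q v * (‖v i‖ + 2 / 25 * s G m q v * K G m q i) := by
  change ‖sC G m p.1 p.2 • p.2 i‖ ≤ _
  rw [norm_smul]
  have hs := s_pos hN hG hm hq v
  have hv : ‖p.2 i‖ ≤ ‖v i‖ + 2 / 25 * s G m q v * K G m q i := by
    have h1 := norm_add_le (p.2 i - toComplex v i) (toComplex v i)
    rw [sub_add_cancel, norm_toComplex] at h1
    linarith [hp.2 i]
  gcongr
  exact norm_sC_le hN hG hm hq hp

end Estimates

end NBody

/-! ### Holomorphic solutions on discs of uniform radius -/

open Filter Topology Metric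

theorem HasDerivAt.comp_ofReal_of_normedSpace {E : Type*} [NormedAddCommGroup E] [NormedSpace ℂ E]
    {g : ℂ → E} {g' : E} {t : ℝ} (h : HasDerivAt g g' (t : ℂ)) :
    HasDerivAt (fun t : ℝ => g t) g' t := by
  simpa [Function.comp_def] using h.scomp t ((hasDerivAt_id t).ofReal_comp)

theorem norm_map_sub_le_of_hasDerivAt_ball {E E' : Type*} [NormedAddCommGroup E] [NormedSpace ℂ E]
    [NormedAddCommGroup E'] [NormedSpace ℂ E'] (L : E →L[ℂ] E') {g : ℂ → E} {R M : ℝ}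
    (hM : 0 ≤ M) (hd : ∀ z ∈ ball (0 : ℂ) R, ∃ g', HasDerivAt g g' z ∧ ‖L g'‖ ≤ M) {z : ℂ}
    (hz : z ∈ ball (0 : ℂ) R) : ‖L (g z) - L (g 0)‖ ≤ R * M := by
  choose! g' hg' hb using hd
  have hz' := mem_ball_zero_iff.mp hz
  have h := (convex_ball (0 : ℂ) R).norm_image_sub_le_of_norm_hasDerivWithin_le
    (f := fun z => L (g z)) (f' := fun z => L (g' z)) (C := M)
    (fun w hw => (L.hasFDerivAt.comp_hasDerivAt w (hg' w hw)).hasDerivWithinAt) hb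
    (mem_ball_self ((norm_nonneg z).trans_lt hz')) hz
  rw [sub_zero] at h
  nlinarith

theorem map_eq_of_hasDerivAt_ball {E E' : Type*} [NormedAddCommGroup E] [NormedSpace ℂ E]
    [NormedAddCommGroup E'] [NormedSpace ℝ E'] (L : E →L[ℝ] E') {g : ℂ → E} {R : ℝ}
    (hd : ∀ t : ℝ, (t : ℂ) ∈ ball (0 : ℂ) R → ∃ g', HasDerivAt g g' t ∧ L g' = 0) {t : ℝ}
    (ht : (t : ℂ) ∈ ball (0 : ℂ) R) : L (g t) = L (g 0) := by
  have hball : ∀ u : ℝ, u ∈ ball (0 : ℝ) R → (u : ℂ) ∈ ball (0 : ℂ) R := fun u hu => by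
    rw [mem_ball_zero_iff] at hu ⊢
    rwa [Complex.norm_real]
  have ht' : t ∈ ball (0 : ℝ) R := by
    rw [mem_ball_zero_iff] at ht ⊢
    rwa [Complex.norm_real] at ht
  choose! g' hg' hb using hd
  have h := (convex_ball (0 : ℝ) R).norm_image_sub_le_of_norm_hasDerivWithin_le
    (f := fun u : ℝ => L (g u)) (f' := fun u => L (g' u)) (C := 0)
    (fun u hu => (L.hasFDerivAt.comp_hasDerivAt u
      (hg' u (hball u hu)).comp_ofReal_of_normedSpace).hasDerivWithinAt)
    (fun u hu => by simp [hb u (hball u hu)])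
    (mem_ball_self ((norm_nonneg t).trans_lt (mem_ball_zero_iff.mp ht'))) ht'
  rw [zero_mul] at h
  simpa using sub_eq_zero.mp (norm_le_zero_iff.mp h)

namespace NBody

variable {N : ℕ} {G : ℝ} {m : Fin N → ℝ}

theorem notMem_collisionSet_of_toComplex {q v : Config N}
    (h : (toComplex q, toComplex v) ∈ complexDomain G m) : q ∉ collisionSet N := by
  rintro ⟨i, j, hij, e⟩
  have := Complex.slitPlane_ne_zero (h.1 i j hij)
  rw [pairSq_toComplex, e] at this
  simp at this

/-- States with vanishing imaginary part. -/
def realStates (N : ℕ) : Set (CConfig N × CConfig N) :=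
  {p | imConfig p.1 = 0 ∧ imConfig p.2 = 0}

theorem toComplex_mem_realStates (q v : Config N) : (toComplex q, toComplex v) ∈ realStates N :=
  ⟨imConfig_toComplex q, imConfig_toComplex v⟩

theorem toComplex_reConfig_of_mem {p : CConfig N × CConfig N} (hp : p ∈ realStates N) :
    (toComplex (reConfig p.1), toComplex (reConfig p.2)) = p :=
  Prod.ext (toComplex_reConfig hp.1) (toComplex_reConfig hp.2)

theorem renormFieldC_mem_realStates (hN : 2 ≤ N) (hG : 0 < G) (hm : ∀ i, 0 < m i)
    {p : CConfig N × CConfig N} (hp : p ∈ complexDomain G m) (hr : p ∈ realStates N) :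
    renormFieldC G m p ∈ realStates N := by
  have e := toComplex_reConfig_of_mem hr
  rw [← e] at hp ⊢
  rw [renormFieldC_toComplex hN hG hm (notMem_collisionSet_of_toComplex hp)]
  exact toComplex_mem_realStates _ _

/-- Bounded part of `nearStates`, on which Picard iteration takes place. -/
def picardStates (G : ℝ) (m : Fin N → ℝ) (q v : Config N) : Set (CConfig N × CConfig N) :=
  nearStates G m q v ∩ {p | ∀ i, ‖p.1 i - toComplex q i‖ ≤
    9 / 200 * (4 / 3 * s G m q v * (‖v i‖ + 2 / 25 * s G m q v * K G m q i))}

theorem isClosed_nearStates (q v : Config N) : IsClosed (nearStates G m q v) := by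
  refine IsClosed.inter (?_ : IsClosed {p : CConfig N × CConfig N | ∀ i j, _})
    (?_ : IsClosed {p : CConfig N × CConfig N | ∀ i, _})
  · simp only [ofPred_forall]
    exact isClosed_iInter fun i => isClosed_iInter fun j => isClosed_le (by fun_prop) (by fun_prop)
  · simp only [ofPred_forall]
    exact isClosed_iInter fun i => isClosed_le (by fun_prop) (by fun_prop)

/-- `nearStates` only sees relative positions and is unbounded under common translations. The extra
bound on absolute positions restores compactness, which yields one Lipschitz constant. -/
theorem isCompact_picardStates (q v : Config N) : IsCompact (picardStates G m q v) := by
  have hcl : IsClosed (picardStates G m q v) := by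
    refine (isClosed_nearStates q v).inter ?_
    simp only [ofPred_forall]
    exact isClosed_iInter fun i => isClosed_le (by fun_prop) (by fun_prop)
  refine IsCompact.of_isClosed_subset ((isCompact_univ_pi fun i : Fin N =>
    isCompact_closedBall (toComplex q i)
      (9 / 200 * (4 / 3 * s G m q v * (‖v i‖ + 2 / 25 * s G m q v * K G m q i)))).prod
    (isCompact_univ_pi fun i : Fin N =>
      isCompact_closedBall (toComplex v i) (2 / 25 * s G m q v * K G m q i))) hcl ?_
  rintro p ⟨h1, h2⟩
  exact ⟨fun i _ => mem_closedBall_iff_norm.mpr (h2 i),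
    fun i _ => mem_closedBall_iff_norm.mpr (h1.2 i)⟩

theorem isClosed_realStates : IsClosed (realStates N) :=
  (isClosed_eq (by fun_prop) (by fun_prop)).inter (isClosed_eq (by fun_prop) (by fun_prop))

theorem toComplex_mem_picardStates (hN : 2 ≤ N) (hG : 0 < G) (hm : ∀ i, 0 < m i) {q : Config N}
    (hq : q ∉ collisionSet N) (v : Config N) :
    (toComplex q, toComplex v) ∈ picardStates G m q v := by
  have hs := s_pos hN hG hm hq v
  refine ⟨⟨fun i j => ?_, fun i => ?_⟩, fun i => ?_⟩
  · simp
  · have := K_nonneg hG hm q i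
    simp only [sub_self, norm_zero]
    positivity
  · have := K_nonneg hG hm q i
    simp only [sub_self, norm_zero]
    positivity

/-- The holomorphic solution starting at a real state exists on a disc of uniform radius, and is
real on the real axis. -/
theorem exists_disc_solution (hN : 2 ≤ N) (hG : 0 < G) (hm : ∀ i, 0 < m i) {q : Config N}
    (hq : q ∉ collisionSet N) (v : Config N) :
    ∃ Y : ℂ → CConfig N × CConfig N, Y 0 = (toComplex q, toComplex v) ∧
      ∀ z ∈ ball (0 : ℂ) (9 / 200), Y z ∈ complexDomain G m ∧
        HasDerivAt Y (renormFieldC G m (Y z)) z ∧ (z.im = 0 → Y z ∈ realStates N) := by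
  have hs := s_pos hN hG hm hq v
  have hdom : picardStates G m q v ⊆ complexDomain G m :=
    inter_subset_left.trans (nearStates_subset_complexDomain hN hG hm hq)
  have hloc : LocallyLipschitzOn (picardStates G m q v) (renormFieldC G m) := by
    intro p hp
    obtain ⟨K, t, ht, hL⟩ := (contDiffAt_renormFieldC (hdom hp)).exists_lipschitzOnWith
    exact ⟨K, t, mem_nhdsWithin_of_mem_nhds ht, hL⟩
  obtain ⟨C, hC⟩ := hloc.exists_lipschitzOnWith_of_compact (isCompact_picardStates q v)
  have hmem := toComplex_mem_picardStates hN hG hm hq v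
  -- Reality is imposed at real times only, and the iteration preserves it. The limit is thus real
  -- on the real axis with no separate argument by conjugation.
  let D : ℂ → Set (CConfig N × CConfig N) := fun z =>
    picardStates G m q v ∩ {p | z.im = 0 → p ∈ realStates N}
  have hDcl : ∀ z, IsClosed (D z) := by
    intro z
    refine (isCompact_picardStates q v).isClosed.inter ?_
    by_cases h : z.im = 0
    · simpa [h] using isClosed_realStates
    · simp [h]
  have hinv : ∀ g : ℂ → CConfig N × CConfig N, g 0 = (toComplex q, toComplex v) →
      (∀ z ∈ ball (0 : ℂ) (9 / 200), ∃ p ∈ D z, HasDerivAt g (renormFieldC G m p) z) →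
      ∀ z ∈ ball (0 : ℂ) (9 / 200), g z ∈ D z := by
    intro g hg0 hg z hz
    let P : Fin N → CConfig N →L[ℂ] EuclideanSpace ℂ (Fin 3) := fun i =>
      ContinuousLinearMap.proj (R := ℂ) (φ := fun _ : Fin N => EuclideanSpace ℂ (Fin 3)) i
    let L₁ := ContinuousLinearMap.fst ℂ (CConfig N) (CConfig N)
    let L₂ := ContinuousLinearMap.snd ℂ (CConfig N) (CConfig N)
    have hK := K_nonneg hG hm q
    refine ⟨⟨⟨fun i j => ?_, fun i => ?_⟩, fun i => ?_⟩, fun hz0 => ?_⟩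
    · have h := norm_map_sub_le_of_hasDerivAt_ball (P i ∘L L₁ - P j ∘L L₁) (g := g)
        (R := 9 / 200) (M := 4 / 3 * ‖q i - q j‖) (by positivity) (fun w hw => by
          obtain ⟨p, hp, hd⟩ := hg w hw
          exact ⟨_, hd, norm_renormFieldC_fst_sub_le hN hG hm hq hp.1.1 i j⟩) hz
      rw [hg0] at h
      change ‖((g z).1 i - (g z).1 j) - (toComplex q i - toComplex q j)‖ ≤ _ at h
      -- `9/200 * 4/3 = 3/50 ≤ 1/16`.
      exact h.trans (by linarith [norm_nonneg (q i - q j)])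
    · have h := norm_map_sub_le_of_hasDerivAt_ball (P i ∘L L₂) (g := g)
        (R := 9 / 200) (M := 16 / 9 * s G m q v * K G m q i)
        (by have := hK i; positivity) (fun w hw => by
          obtain ⟨p, hp, hd⟩ := hg w hw
          exact ⟨_, hd, norm_renormFieldC_snd_le hN hG hm hq hp.1.1 i⟩) hz
      rw [hg0] at h
      change ‖(g z).2 i - toComplex v i‖ ≤ _ at h
      -- `9/200 * 16/9 = 2/25` exactly: the velocity constraint determines the radius.
      exact h.trans_eq (by ring)
    · have h := norm_map_sub_le_of_hasDerivAt_ball (P i ∘L L₁) (g := g) (R := 9 / 200)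
        (M := 4 / 3 * s G m q v * (‖v i‖ + 2 / 25 * s G m q v * K G m q i))
        (by have := hK i; positivity) (fun w hw => by
          obtain ⟨p, hp, hd⟩ := hg w hw
          exact ⟨_, hd, norm_renormFieldC_fst_le hN hG hm hq hp.1.1 i⟩) hz
      rwa [hg0] at h
    · obtain ⟨t, rfl⟩ : ∃ t : ℝ, (t : ℂ) = z := ⟨z.re, Complex.ext rfl (by simp [hz0])⟩
      have hreal : ∀ u : ℝ, (u : ℂ) ∈ ball (0 : ℂ) (9 / 200) →
          ∃ g', HasDerivAt g g' u ∧ g' ∈ realStates N := fun u hu => by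
        obtain ⟨p, hp, hd⟩ := hg u hu
        exact ⟨_, hd, renormFieldC_mem_realStates hN hG hm (hdom hp.1) (hp.2 (by simp))⟩
      -- The field is real at real states, so the imaginary part of `g` is constant along the real
      -- axis.
      have h1 := map_eq_of_hasDerivAt_ball (imConfig ∘L L₁.restrictScalars ℝ)
        (fun u hu => (hreal u hu).imp fun g' h => ⟨h.1, h.2.1⟩) hz
      have h2 := map_eq_of_hasDerivAt_ball (imConfig ∘L L₂.restrictScalars ℝ)
        (fun u hu => (hreal u hu).imp fun g' h => ⟨h.1, h.2.2⟩) hz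
      rw [hg0] at h1 h2
      exact ⟨h1.trans (imConfig_toComplex q), h2.trans (imConfig_toComplex v)⟩
  obtain ⟨Y, hY0, hY⟩ := exists_holomorphic_solution_of_invariant hDcl
    (fun z => inter_subset_left) hC
    (fun p hp => (analyticAt_renormFieldC (hdom hp)).differentiableAt)
    (fun z => ⟨hmem, fun _ => toComplex_mem_realStates q v⟩) hinv
  exact ⟨Y, hY0, fun z hz => ⟨hdom (hY z hz).1.1, (hY z hz).2, (hY z hz).1.2⟩⟩

end NBody

namespace NBody

open Filter Topology Metric

variable {N : ℕ} {G : ℝ} {m : Fin N → ℝ}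

theorem hasDerivAt_fst_of_prod {𝕜 E E' : Type*} [NontriviallyNormedField 𝕜] [NormedAddCommGroup E]
    [NormedSpace 𝕜 E] [NormedAddCommGroup E'] [NormedSpace 𝕜 E'] {f : 𝕜 → E × E'} {f' : E × E'}
    {x : 𝕜} (h : HasDerivAt f f' x) : HasDerivAt (fun x => (f x).1) f'.1 x :=
  (ContinuousLinearMap.fst 𝕜 E E').hasFDerivAt.comp_hasDerivAt x h

theorem hasDerivAt_snd_of_prod {𝕜 E E' : Type*} [NontriviallyNormedField 𝕜] [NormedAddCommGroup E]
    [NormedSpace 𝕜 E] [NormedAddCommGroup E'] [NormedSpace 𝕜 E'] {f : 𝕜 → E × E'} {f' : E × E'}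
    {x : 𝕜} (h : HasDerivAt f f' x) : HasDerivAt (fun x => (f x).2) f'.2 x :=
  (ContinuousLinearMap.snd 𝕜 E E').hasFDerivAt.comp_hasDerivAt x h

/-! ### Global real solutions -/

/-- The renormalized equations have global real solutions. -/
theorem exists_global_solution (hN : 2 ≤ N) (hG : 0 < G) (hm : ∀ i, 0 < m i) {q : Config N}
    (hq : q ∉ collisionSet N) (v : Config N) :
    ∃ p : ℝ → Config N × Config N, p 0 = (q, v) ∧
      ∀ t, (p t).1 ∉ collisionSet N ∧ HasDerivAt p (renormField G m (p t)) t := by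
  refine ODE_exists_global (U := {p : Config N × Config N | p.1 ∉ collisionSet N})
    (F := renormField G m)
    (fun x hx => (contDiffAt_renormField hN hG hm hx).of_le le_top)
    (ρ := 9 / 200) (by norm_num) ?_ (x := (q, v)) hq
  rintro ⟨q, v⟩ hq
  obtain ⟨Y, hY0, hY⟩ := exists_disc_solution hN hG hm hq v
  let M : CConfig N × CConfig N →L[ℝ] Config N × Config N := reConfig.prodMap reConfig
  refine ⟨fun t => M (Y t), ?_, fun t ht => ?_⟩
  · simp [M, hY0, reConfig_toComplex]
  have htb : (t : ℂ) ∈ ball (0 : ℂ) (9 / 200) := by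
    rw [mem_ball_zero_iff, Complex.norm_real]
    exact abs_lt.mpr ht
  obtain ⟨hdom, hder, hreal⟩ := hY t htb
  have e := toComplex_reConfig_of_mem (hreal (Complex.ofReal_im t))
  have hq' : reConfig (Y t).1 ∉ collisionSet N := by
    rw [← e] at hdom
    exact notMem_collisionSet_of_toComplex hdom
  refine ⟨hq', ?_⟩
  have h := M.hasFDerivAt.comp_hasDerivAt t hder.comp_ofReal_of_normedSpace
  have e' : M (renormFieldC G m (Y t)) = renormField G m (M (Y t)) := by
    conv_lhs => rw [← e, renormFieldC_toComplex hN hG hm hq']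
    simp only [M]
    simp [reConfig_toComplex, Prod.map]
  rwa [e'] at h

/-! ### The holomorphic extension -/

/-- The complexification of a real curve solving the renormalized equations solves the
complexified equations. -/
theorem hasDerivAt_toComplex (hN : 2 ≤ N) (hG : 0 < G) (hm : ∀ i, 0 < m i)
    {p : ℝ → Config N × Config N} {t : ℝ} (hq : (p t).1 ∉ collisionSet N)
    (h : HasDerivAt p (renormField G m (p t)) t) :
    HasDerivAt (fun t => (toComplex (p t).1, toComplex (p t).2))
      (renormFieldC G m (toComplex (p t).1, toComplex (p t).2)) t := by
  have := (toComplexL.prodMap toComplexL).hasFDerivAt.comp_hasDerivAt t h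
  rwa [renormFieldC_toComplex hN hG hm hq]

/-- A disc solution is started at every real time `a`. By ODE uniqueness each agrees with the given
curve on the real axis, so all of them glue. -/
theorem exists_strip_extension (hN : 2 ≤ N) (hG : 0 < G) (hm : ∀ i, 0 < m i)
    {p : ℝ → Config N × Config N}
    (hp : ∀ t, (p t).1 ∉ collisionSet N ∧ HasDerivAt p (renormField G m (p t)) t) :
    ∃ W : ℂ → CConfig N × CConfig N,
      (∀ t : ℝ, W t = (toComplex (p t).1, toComplex (p t).2)) ∧
      ∀ z : ℂ, |z.im| < 9 / 200 → W z ∈ complexDomain G m ∧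
        HasDerivAt W (renormFieldC G m (W z)) z := by
  have hex := fun a : ℝ => exists_disc_solution hN hG hm (hp a).1 (p a).2
  choose Y hY0 hY using hex
  let Z : ℝ → ℂ → CConfig N × CConfig N := fun a z => Y a (z - a)
  have hZ : ∀ a : ℝ, ∀ z ∈ ball (a : ℂ) (9 / 200), Z a z ∈ complexDomain G m ∧
      HasDerivAt (Z a) (renormFieldC G m (Z a z)) z := by
    intro a z hz
    have hz' : z - a ∈ ball (0 : ℂ) (9 / 200) := by
      rwa [mem_ball_zero_iff, ← mem_ball_iff_norm]
    obtain ⟨h1, h2, -⟩ := hY a _ hz'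
    exact ⟨h1, by simpa using h2.comp_sub_const z (a : ℂ)⟩
  have hZp : ∀ a t : ℝ, |t - a| < 9 / 200 → Z a t = (toComplex (p t).1, toComplex (p t).2) := by
    intro a t ht
    have hb : ∀ u ∈ ball a (9 / 200), (u : ℂ) ∈ ball (a : ℂ) (9 / 200) := fun u hu => by
      rw [mem_ball_iff_norm] at hu ⊢
      rwa [← Complex.ofReal_sub, Complex.norm_real]
    refine ODE_eqOn_of_isPreconnected (F := renormFieldC G m) (U := complexDomain G m)
      (fun x hx => contDiffAt_renormFieldC hx) (J := ball a (9 / 200)) isOpen_ball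
      (convex_ball _ _).isPreconnected (f := fun t : ℝ => Z a t)
      (fun u hu => ⟨(hZ a u (hb u hu)).1, (hZ a u (hb u hu)).2.comp_ofReal_of_normedSpace⟩)
      (fun u _ => hasDerivAt_toComplex hN hG hm (hp u).1 (hp u).2) (t₀ := a)
      (mem_ball_self (by norm_num)) (by simp [Z, hY0]) (mem_ball_iff_norm.mpr ht)
  obtain ⟨W, hW⟩ := exists_glue_discs
    (fun a z hz => (hZ a z hz).2.differentiableAt.differentiableWithinAt) hZp
  refine ⟨W, fun t => ?_, fun z hz => ?_⟩
  · rw [hW t (mem_ball_self (by norm_num)), hZp t t (by norm_num)]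
  · have hzb : z ∈ ball (z.re : ℂ) (9 / 200) := by
      rw [mem_ball_iff_norm]
      have e : z - z.re = (z.im : ℂ) * Complex.I := by
        apply Complex.ext <;> simp
      rwa [e, norm_mul, Complex.norm_I, mul_one, Complex.norm_real]
    rw [hW _ hzb]
    exact ⟨(hZ _ z hzb).1, (hZ _ z hzb).2.congr_of_eventuallyEq
      ((hW z.re).eventuallyEq_of_mem (isOpen_ball.mem_nhds hzb))⟩

theorem eqOn_strip {E : Type*} [NormedAddCommGroup E] [NormedSpace ℂ E] {β : ℝ} (hβ : 0 ≤ β)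
    {f g : ℂ → E} (hf : AnalyticOnNhd ℂ f (strip β)) (hg : AnalyticOnNhd ℂ g (strip β))
    (h : ∀ t : ℝ, f t = g t) : EqOn f g (strip β) := by
  have hconv : Convex ℝ (strip β) := by
    have e : strip β = Complex.imLm ⁻¹' Icc (-β) β := by
      ext z; simp [strip, abs_le]
    rw [e]
    exact (convex_Icc (-β) β).linear_preimage Complex.imLm
  exact hf.eqOn_of_preconnected_of_frequently_eq hg hconv.isPreconnected
    (z₀ := ((0 : ℝ) : ℂ)) (by simpa [strip] using hβ)
    (frequently_eq_of_eventually_ofReal (Eventually.of_forall h))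

theorem analyticOnNhd_strip {E : Type*} [NormedAddCommGroup E] [NormedSpace ℂ E] [CompleteSpace E]
    {β R : ℝ} (hβ : β < R) {W : ℂ → E} (h : ∀ z : ℂ, |z.im| < R → DifferentiableAt ℂ W z) :
    AnalyticOnNhd ℂ W (strip β) := by
  have hopen : IsOpen {z : ℂ | |z.im| < R} := isOpen_lt (by fun_prop) continuous_const
  have hd : DifferentiableOn ℂ W {z : ℂ | |z.im| < R} :=
    fun z hz => (h z hz).differentiableWithinAt
  exact (hd.analyticOnNhd hopen).mono fun z hz => lt_of_le_of_lt hz hβ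

/-- A holomorphic solution of the complexified equations is determined by its initial value. -/
theorem holomorphic_solution_unique {β : ℝ} (hβ : 0 ≤ β) {Q V Q' V' : ℂ → CConfig N}
    (h : IsHolomorphicRenormSolutionOn G m (strip β) Q V)
    (h' : IsHolomorphicRenormSolutionOn G m (strip β) Q' V') (hQ : Q' 0 = Q 0)
    (hV : V' 0 = V 0) : EqOn Q' Q (strip β) ∧ EqOn V' V (strip β) := by
  have hmem : ∀ t : ℝ, (t : ℂ) ∈ strip β := fun t => by simpa [strip] using hβ
  have key : ∀ {Q V : ℂ → CConfig N}, IsHolomorphicRenormSolutionOn G m (strip β) Q V →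
      ∀ t : ℝ, (Q t, V t) ∈ complexDomain G m ∧
        HasDerivAt (fun t : ℝ => (Q t, V t)) (renormFieldC G m (Q t, V t)) t := by
    intro Q V h t
    obtain ⟨h1, h2, h3⟩ := h.2.2 t (hmem t)
    exact ⟨h1, h2.comp_ofReal_of_normedSpace.prodMk h3.comp_ofReal_of_normedSpace⟩
  have heq := ODE_eqOn_of_isPreconnected (F := renormFieldC G m) (U := complexDomain G m)
    (fun x hx => contDiffAt_renormFieldC hx) isOpen_univ isPreconnected_univ
    (fun t _ => key h' t) (fun t _ => (key h t).2) (mem_univ (0 : ℝ)) (by simp [hQ, hV])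
  exact ⟨eqOn_strip hβ h'.1 h.1 fun t => congrArg Prod.fst (heq (mem_univ t)),
    eqOn_strip hβ h'.2.1 h.2.1 fun t => congrArg Prod.snd (heq (mem_univ t))⟩

theorem real_solution_unique (hN : 2 ≤ N) (hG : 0 < G) (hm : ∀ i, 0 < m i)
    {p : ℝ → Config N × Config N}
    (hp : ∀ t, (p t).1 ∉ collisionSet N ∧ HasDerivAt p (renormField G m (p t)) t)
    {J : Set ℝ} {q v : ℝ → Config N} (hJo : IsOpen J) (hJ : J.OrdConnected) (h0 : (0 : ℝ) ∈ J)
    (hq0 : q 0 = (p 0).1) (hv0 : v 0 = (p 0).2)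
    (h : IsRenormSolutionOn G m (s G m) J q v) :
    EqOn q (fun t => (p t).1) J ∧ EqOn v (fun t => (p t).2) J := by
  have heq := ODE_eqOn_of_isPreconnected (F := renormField G m)
    (U := {p : Config N × Config N | p.1 ∉ collisionSet N})
    (fun x hx => (contDiffAt_renormField hN hG hm hx).of_le le_top) hJo hJ.isPreconnected
    (f := fun t => (q t, v t)) (fun t ht => ⟨(h t ht).1, (h t ht).2.1.prodMk (h t ht).2.2⟩)
    (fun t _ => (hp t).2) h0 (by simp [hq0, hv0])
  exact ⟨fun t ht => congrArg Prod.fst (heq ht), fun t ht => congrArg Prod.snd (heq ht)⟩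

/-! ### Back to physical time -/

theorem continuousAt_s (hN : 2 ≤ N) (hG : 0 < G) (hm : ∀ i, 0 < m i) {q v : ℝ → Config N} {t : ℝ}
    (hq : q t ∉ collisionSet N) (h1 : ContinuousAt q t) (h2 : ContinuousAt v t) :
    ContinuousAt (fun t => s G m (q t) (v t)) t :=
  ContinuousAt.comp (g := fun p : Config N × Config N => s G m p.1 p.2) (f := fun t => (q t, v t))
    (contDiffAt_s hN hG hm (p := (q t, v t)) hq).continuousAt (h1.prodMk h2)

theorem continuousOn_inv_s (hN : 2 ≤ N) (hG : 0 < G) (hm : ∀ i, 0 < m i) {I : Set ℝ}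
    {q v : ℝ → Config N} (h : IsSolutionOn G m I q v) :
    ContinuousOn (fun t => (s G m (q t) (v t))⁻¹) I := fun t ht =>
  ((continuousAt_s hN hG hm (h t ht).1 (h t ht).2.1.continuousAt
    (h t ht).2.2.continuousAt).inv₀ (s_pos hN hG hm (h t ht).1 _).ne').continuousWithinAt

/-- A solution whose fictitious time runs over all of `ℝ` is maximal. -/
theorem isMaximalSolution_of_bijOn (hN : 2 ≤ N) (hG : 0 < G) (hm : ∀ i, 0 < m i) {I : Set ℝ}
    (hI : I.OrdConnected) (h0 : (0 : ℝ) ∈ I) {q v : ℝ → Config N}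
    (hmono : StrictMonoOn (fictitiousTime (s G m) q v) I)
    (hsurj : SurjOn (fictitiousTime (s G m) q v) I univ)
    {J : Set ℝ} {q' v' : ℝ → Config N} (hJ : J.OrdConnected) (hIJ : I ⊆ J)
    (hsol : IsSolutionOn G m J q' v') (hq : EqOn q' q I) (hv : EqOn v' v I) : J = I := by
  refine Subset.antisymm (fun x hx => ?_) hIJ
  by_contra hxI
  have hx0 : uIcc 0 x ⊆ J := hJ.uIcc_subset (hIJ h0) hx
  obtain ⟨M, hM⟩ := isCompact_uIcc.exists_bound_of_continuousOn
    ((continuousOn_inv_s hN hG hm hsol).mono hx0)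
  have hM0 : 0 ≤ M := (norm_nonneg _).trans (hM 0 left_mem_uIcc)
  have hθ0 : fictitiousTime (s G m) q v 0 = 0 := by simp [fictitiousTime]
  have hbound : ∀ y ∈ I, y ∈ uIcc 0 x → |fictitiousTime (s G m) q v y| ≤ M * |x| := by
    intro y hy hyx
    have hsub : uIcc 0 y ⊆ I := hI.uIcc_subset h0 hy
    have h := intervalIntegral.norm_integral_le_of_norm_le_const
      (a := 0) (b := y) (C := M) (f := fun t => (s G m (q t) (v t))⁻¹) (fun t ht => by
        have htI := hsub (uIoc_subset_uIcc ht)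
        rw [← hq htI, ← hv htI]
        exact hM t (uIcc_subset_uIcc left_mem_uIcc hyx (uIoc_subset_uIcc ht)))
    rw [sub_zero] at h
    have hyx' : |y| ≤ |x| := by simpa using abs_sub_left_of_mem_uIcc hyx
    exact h.trans (mul_le_mul_of_nonneg_left hyx' hM0)
  have hB : 0 ≤ M * |x| := mul_nonneg hM0 (abs_nonneg x)
  rcases le_total 0 x with hx' | hx'
  -- A value of θ above its bound on `[0, x]`. The time `y` attaining it lies in `I`, and `I` cannot
  -- reach past `x ∉ I`, so `y` is in `[0, x]`, a contradiction.
  · obtain ⟨y, hy, hyt⟩ := hsurj (mem_univ (M * |x| + 1))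
    have hy0 : 0 ≤ y := by
      by_contra hneg
      have := hmono hy h0 (not_le.mp hneg)
      linarith
    have hyx : y ≤ x := by
      by_contra hlt
      exact hxI (hI.out h0 hy ⟨hx', (not_le.mp hlt).le⟩)
    have := hbound y hy (by rw [uIcc_of_le hx']; exact ⟨hy0, hyx⟩)
    rw [hyt] at this
    linarith [le_abs_self (M * |x| + 1)]
  · obtain ⟨y, hy, hyt⟩ := hsurj (mem_univ (-(M * |x| + 1)))
    have hy0 : y ≤ 0 := by
      by_contra hpos
      have := hmono h0 hy (not_le.mp hpos)
      linarith
    have hyx : x ≤ y := by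
      by_contra hlt
      exact hxI (hI.out hy h0 ⟨(not_le.mp hlt).le, hx'⟩)
    have := hbound y hy (by rw [uIcc_of_ge hx']; exact ⟨hyx, hy0⟩)
    rw [hyt, abs_neg] at this
    linarith [le_abs_self (M * |x| + 1)]

/-- A global solution of the renormalized equations gives, after the change of time, the maximal
solution of the `N`-body equations. -/
theorem exists_maximal_solution (hN : 2 ≤ N) (hG : 0 < G) (hm : ∀ i, 0 < m i)
    {p : ℝ → Config N × Config N}
    (hp : ∀ t, (p t).1 ∉ collisionSet N ∧ HasDerivAt p (renormField G m (p t)) t) :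
    ∃ (I : Set ℝ) (q v : ℝ → Config N),
      IsMaximalSolution G m (p 0).1 (p 0).2 I q v ∧
      BijOn (fictitiousTime (s G m) q v) I univ ∧
      ∀ t ∈ I, (p (fictitiousTime (s G m) q v t)).1 = q t ∧
        (p (fictitiousTime (s G m) q v t)).2 = v t := by
  let σ : ℝ → ℝ := fun τ => s G m (p τ).1 (p τ).2
  have hσpos : ∀ τ, 0 < σ τ := fun τ => s_pos hN hG hm (hp τ).1 _
  have hσ : Continuous σ := continuous_iff_continuousAt.mpr fun τ =>
    continuousAt_s hN hG hm (hp τ).1 (hasDerivAt_fst_of_prod (hp τ).2).continuousAt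
      (hasDerivAt_snd_of_prod (hp τ).2).continuousAt
  -- Physical time as a function of fictitious time; its range, possibly bounded, will be the
  -- maximal interval.
  let T : ℝ → ℝ := fun τ => ∫ u in (0 : ℝ)..τ, σ u
  have hT : ∀ τ, HasStrictDerivAt T (σ τ) τ := fun τ => hσ.integral_hasStrictDerivAt 0 τ
  have hTmono : StrictMono T := strictMono_of_hasDerivAt_pos (fun τ => (hT τ).hasDerivAt) hσpos
  have hTcont : Continuous T := continuous_iff_continuousAt.mpr fun τ => (hT τ).hasDerivAt.continuousAt
  have hTemb : IsOpenEmbedding T := IsOpenEmbedding.of_continuous_injective_isOpenMap hTcont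
    hTmono.injective (isOpenMap_of_hasStrictDerivAt hT fun τ => (hσpos τ).ne')
  let e := hTemb.toOpenPartialHomeomorph T
  have heT : ∀ τ, e.symm (T τ) = τ := fun τ => e.left_inv (by simp [e])
  have hT0 : T 0 = 0 := by simp [T]
  have he0 : e.symm 0 = 0 := by simpa [hT0] using heT 0
  have hI : (range T).OrdConnected := (isPreconnected_range hTcont).ordConnected
  have h0 : (0 : ℝ) ∈ range T := ⟨0, hT0⟩
  have hder : ∀ t ∈ range T, HasDerivAt e.symm (σ (e.symm t))⁻¹ t := by
    rintro t ⟨τ, rfl⟩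
    refine e.hasDerivAt_symm (by simp [e]) (hσpos _).ne' ?_
    rw [heT]
    exact (hT τ).hasDerivAt
  let q : ℝ → Config N := fun t => (p (e.symm t)).1
  let v : ℝ → Config N := fun t => (p (e.symm t)).2
  have hsol : IsSolutionOn G m (range T) q v := by
    intro t ht
    have h := (hp (e.symm t)).2.scomp t (hder t ht)
    have e' : (σ (e.symm t))⁻¹ • renormField G m (p (e.symm t)) = (v t, accel G m (q t)) := by
      have hne := (hσpos (e.symm t)).ne'
      simp only [renormField, Prod.smul_mk, smul_smul]
      rw [inv_mul_cancel₀ hne, one_smul, one_smul]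
    rw [e'] at h
    exact ⟨(hp _).1, hasDerivAt_fst_of_prod h, hasDerivAt_snd_of_prod h⟩
  -- The inverse of `T` has derivative `s⁻¹` and vanishes at `0`, so it is the integral defining θ.
  have hθ : EqOn (fictitiousTime (s G m) q v) e.symm (range T) := by
    intro t ht
    have hsub : uIcc 0 t ⊆ range T := hI.uIcc_subset h0 ht
    have h := intervalIntegral.integral_eq_sub_of_hasDerivAt (fun u hu => hder u (hsub hu))
      (((continuousOn_inv_s hN hG hm hsol).mono hsub).intervalIntegrable)
    rw [he0, sub_zero] at h
    exact h
  have hθT : ∀ τ, fictitiousTime (s G m) q v (T τ) = τ := fun τ => (hθ ⟨τ, rfl⟩).trans (heT τ)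
  have hmono : StrictMonoOn (fictitiousTime (s G m) q v) (range T) := by
    rintro _ ⟨τ, rfl⟩ _ ⟨τ', rfl⟩ h
    rw [hθT, hθT]
    exact hTmono.lt_iff_lt.mp h
  have hsurj : SurjOn (fictitiousTime (s G m) q v) (range T) univ := fun τ _ =>
    ⟨T τ, ⟨τ, rfl⟩, hθT τ⟩
  refine ⟨range T, q, v, ?_, ⟨mapsTo_univ _ _, hmono.injOn, hsurj⟩, fun t ht => ?_⟩
  · exact
      { isOpen := hTemb.isOpen_range
        ordConnected := hI
        zero_mem := h0
        q_zero := by simp only [q, he0]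
        v_zero := by simp only [v, he0]
        isSolutionOn := hsol
        maximal := fun J q' v' _ hJ hIJ hsol' hq hv =>
          isMaximalSolution_of_bijOn hN hG hm hI h0 hmono hsurj hJ hIJ hsol' hq hv }
  · rw [hθ ht]
    exact ⟨rfl, rfl⟩

end NBody

end

theorem theorem2 {N : ℕ} (hN : 2 ≤ N) (G : ℝ) (hG : 0 < G) (m : Fin N → ℝ)
    (hm : ∀ i, 0 < m i) :
    (∀ q₀ v₀ : NBody.Config N, q₀ ∉ NBody.collisionSet N →
      -- the real solution exists for all fictitious times
      ∃ q v : ℝ → NBody.Config N,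
        q 0 = q₀ ∧ v 0 = v₀ ∧ NBody.IsRenormSolutionOn G m (NBody.s G m) Set.univ q v ∧
        -- it is the only solution on every open interval around zero
        (∀ (J : Set ℝ) (q' v' : ℝ → NBody.Config N),
          IsOpen J → J.OrdConnected → (0 : ℝ) ∈ J → q' 0 = q₀ → v' 0 = v₀ →
          NBody.IsRenormSolutionOn G m (NBody.s G m) J q' v' →
          Set.EqOn q' q J ∧ Set.EqOn v' v J) ∧
        -- it extends to a holomorphic solution on the strip
        ∃ Q V : ℂ → NBody.CConfig N,
          NBody.IsHolomorphicExtension 0.0444443 q v Q V ∧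
          NBody.IsHolomorphicRenormSolutionOn G m (NBody.strip 0.0444443) Q V ∧
          -- the holomorphic extension is unique
          (∀ Q' V' : ℂ → NBody.CConfig N,
            NBody.IsHolomorphicExtension 0.0444443 q v Q' V' →
            Set.EqOn Q' Q (NBody.strip 0.0444443) ∧
            Set.EqOn V' V (NBody.strip 0.0444443)) ∧
          -- it is also the only holomorphic solution of the initial value problem
          (∀ Q' V' : ℂ → NBody.CConfig N,
            Q' 0 = NBody.toComplex q₀ → V' 0 = NBody.toComplex v₀ →
            NBody.IsHolomorphicRenormSolutionOn G m (NBody.strip 0.0444443) Q' V' →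
            Set.EqOn Q' Q (NBody.strip 0.0444443) ∧
            Set.EqOn V' V (NBody.strip 0.0444443))) ∧
    NBody.IsUniformGlobalTimeRenormalization G m (NBody.s G m) 0.0444443 := by
  have hβ : (0 : ℝ) ≤ 0.0444443 := by norm_num
  have hβR : (0.0444443 : ℝ) < 9 / 200 := by norm_num
  have main : ∀ q₀ v₀ : NBody.Config N, q₀ ∉ NBody.collisionSet N →
      ∃ p : ℝ → NBody.Config N × NBody.Config N, p 0 = (q₀, v₀) ∧
        (∀ t, (p t).1 ∉ NBody.collisionSet N ∧ HasDerivAt p (NBody.renormField G m (p t)) t) ∧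
        ∃ Q V : ℂ → NBody.CConfig N,
          NBody.IsHolomorphicExtension 0.0444443 (fun t => (p t).1) (fun t => (p t).2) Q V ∧
          NBody.IsHolomorphicRenormSolutionOn G m (NBody.strip 0.0444443) Q V := by
    intro q₀ v₀ hq₀
    obtain ⟨p, hp0, hp⟩ := NBody.exists_global_solution hN hG hm hq₀ v₀
    obtain ⟨W, hWp, hW⟩ := NBody.exists_strip_extension hN hG hm hp
    have hQ : AnalyticOnNhd ℂ (fun z => (W z).1) (NBody.strip 0.0444443) :=
      NBody.analyticOnNhd_strip hβR fun z hz =>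
        (NBody.hasDerivAt_fst_of_prod (hW z hz).2).differentiableAt
    have hV : AnalyticOnNhd ℂ (fun z => (W z).2) (NBody.strip 0.0444443) :=
      NBody.analyticOnNhd_strip hβR fun z hz =>
        (NBody.hasDerivAt_snd_of_prod (hW z hz).2).differentiableAt
    refine ⟨p, hp0, hp, fun z => (W z).1, fun z => (W z).2,
      ⟨hQ, hV, fun t => ⟨congrArg Prod.fst (hWp t), congrArg Prod.snd (hWp t)⟩⟩,
      ⟨hQ, hV, fun z hz => ?_⟩⟩
    obtain ⟨h1, h2⟩ := hW z (lt_of_le_of_lt hz hβR)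
    exact ⟨h1, NBody.hasDerivAt_fst_of_prod h2, NBody.hasDerivAt_snd_of_prod h2⟩
  refine ⟨fun q₀ v₀ hq₀ => ?_, by norm_num, fun p hp => ?_, fun q₀ v₀ hq₀ => ?_⟩
  · obtain ⟨p, hp0, hp, Q, V, hext, hsol⟩ := main q₀ v₀ hq₀
    have hq0 : (p 0).1 = q₀ := congrArg Prod.fst hp0
    have hv0 : (p 0).2 = v₀ := congrArg Prod.snd hp0
    refine ⟨fun t => (p t).1, fun t => (p t).2, hq0, hv0,
      fun t _ => ⟨(hp t).1, NBody.hasDerivAt_fst_of_prod (hp t).2,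
        NBody.hasDerivAt_snd_of_prod (hp t).2⟩,
      fun J q' v' hJo hJ h0 hq' hv' h =>
        NBody.real_solution_unique hN hG hm hp hJo hJ h0 (hq'.trans hq0.symm)
          (hv'.trans hv0.symm) h,
      Q, V, hext, hsol, fun Q' V' h => ?_, fun Q' V' hQ' hV' h => ?_⟩
    · exact ⟨NBody.eqOn_strip hβ h.1 hext.1 fun t => (h.2.2 t).1.trans (hext.2.2 t).1.symm,
        NBody.eqOn_strip hβ h.2.1 hext.2.1 fun t => (h.2.2 t).2.trans (hext.2.2 t).2.symm⟩
    · have h0 := hext.2.2 0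
      simp only [Complex.ofReal_zero, hq0, hv0] at h0
      exact NBody.holomorphic_solution_unique hβ hsol h (hQ'.trans h0.1.symm)
        (hV'.trans h0.2.symm)
  · exact (NBody.contDiffAt_s hN hG hm hp).analyticAt
  · obtain ⟨p, hp0, hp, Q, V, hext, -⟩ := main q₀ v₀ hq₀
    obtain ⟨I, q, v, hmax, hbij, hqv⟩ := NBody.exists_maximal_solution hN hG hm hp
    rw [hp0] at hmax
    exact ⟨I, q, v, hmax, hbij, fun t => (p t).1, fun t => (p t).2, hqv, Q, V, hext⟩
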